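/- Let $m>0$ and let $D_m=-i\sum_{k=1}^4\alpha_k\partial_{x_k}+m\beta$ be the free Dirac operator on $\mathbb C^4$-valued functions on $\mathbb R^4$, with $\beta=\mathrm{diag}(1,1,-1,-1)$, $\alpha_k=\begin{pmatrix}0&\sigma_k\\ \sigma_k&0\end{pmatrix}$ for $k=1,2,3$, where $\sigma_1=\begin{pmatrix}0&-i\\ i&0\end{pmatrix}$, $\sigma_2=\begin{pmatrix}0&1\\ 1&0\end{pmatrix}$, $\sigma_3=\begin{pmatrix}1&0\\ 0&-1\end{pmatrix}$, and $\alpha_4=i\begin{pmatrix}0&I\\ -I&0\end{pmatrix}$. Let $V$ be a measurable Hermitian $4\times4$ matrix potential on $\mathbb R^4$ with a measurable pointwise diagonalization $V=B^*\Lambda B$, where $B$ is unitary and $\Lambda=\mathrm{diag}(\lambda_1,\dots,\lambda_4)$ is real. Put $v=|\Lambda|^{1/2}B$ and $U=\mathrm{diag}(\mathrm{sign}\,\lambda_j)$ with $\mathrm{sign}\,0=1$, so that $V=v^*Uv$ and $U^2=I$. Write $\langle x\rangle=(1+|x|^2)^{1/2}$ and suppose that, for some $C$ and some $\delta>0$,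 all entries of $v$ satisfy $|v_{ij}(x)|\le C\langle x\rangle^{-2-\delta}$. Let $I_{uc}=\mathrm{diag}(1,1,0,0)$ and $M_{uc}f=\int_{\mathbb R^4}I_{uc}f(y)\,dy$. Let $\mathcal G_0=(D_m+m)(-\Delta)^{-1}$, that is, the integral operator with kernel $$\mathcal G_0(x,y)=\frac{i\,\alpha\cdot(x-y)}{2\pi^2|x-y|^4}+\frac{m\,I_{uc}}{2\pi^2|x-y|^2},$$ and let $\mathcal G_1=\frac{m}{2\pi^2}M_{uc}$. On $L^2=L^2(\mathbb R^4;\mathbb C^4)$ consider the bounded operators $T_0=U+v\mathcal G_0v^*$ and $T_1=v\mathcal G_1v^*$. Let $S_1$ be the orthogonal projection onto $S_1L^2=\ker T_0$, and let $S_2L^2\subseteq S_1L^2$ be the kernel of $S_1T_1S_1$ as an operator on $S_1L^2$. A threshold eigenfunction is a nonzero $\psi\in L^2$ that solves $(D_m+V-m)\psi=0$ in the sense of distributions. 1. Let $\psi\neq0$ be a distributional solution of $(D_m+V-m)\psi=0$ such that $\langle x\rangle^{-\varepsilon}\psi\in L^2$ for some $0<\varepsilon\le1$, and suppose that $\phi=Uv\psi\in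 S_1L^2$. Then the following are equivalent: (a) $\phi\in S_2L^2$; (b) $\psi\in L^2$; (c) $\psi$ is a threshold eigenfunction; (d) $M_{uc}v^*\phi=0$. 2. Every threshold eigenfunction is (essentially) bounded. -/

import Mathlib

open MeasureTheory Filter
open scoped ENNReal ContDiff

namespace Dirac4

noncomputable section

/-! ### Spaces and matrices -/

/-- The physical space `ℝ⁴` with its Euclidean norm. -/
abbrev R4 := EuclideanSpace ℝ (Fin 4)

/-- The spinor space `ℂ⁴` with its Hermitian norm. -/
abbrev C4 := EuclideanSpace ℂ (Fin 4)

/-- Complex `4 × 4` matrices. -/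
abbrev Mat4 := Matrix (Fin 4) (Fin 4) ℂ

/-- The Hilbert space `L²(ℝ⁴)` of `ℂ⁴`-valued functions. -/
abbrev L2 := Lp C4 2 (volume : Measure R4)

/-- A matrix acting on spinors. -/
def act (A : Mat4) : C4 →L[ℂ] C4 := Matrix.toEuclideanCLM (n := Fin 4) (𝕜 := ℂ) A

/-- The Japanese bracket `⟨x⟩ = (1 + |x|²)^{1/2}`. -/
def bracket (x : R4) : ℝ := Real.sqrt (1 + ‖x‖ ^ 2)

/-- `|A(x)| ≲ ⟨x⟩^{-s-}`: for some `ε > 0`, every entry is bounded by a multiple of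
`⟨x⟩^{-s-ε}`. -/
def DecaysFasterThan (s : ℝ) (A : R4 → Mat4) : Prop :=
  ∃ C ε : ℝ, 0 < ε ∧ ∀ x i j, ‖A x i j‖ ≤ C * bracket x ^ (-(s + ε))

/-- The weighted space `L^{2,s}(ℝ⁴)`: `⟨x⟩^s f ∈ L²`. -/
def MemL2Weighted (s : ℝ) (f : R4 → C4) : Prop :=
  MemLp (fun x => ((bracket x ^ s : ℝ) : ℂ) • f x) 2 volume

/-- The matrix `β = α₀`. -/
def beta : Mat4 := !![1, 0, 0, 0; 0, 1, 0, 0; 0, 0, -1, 0; 0, 0, 0, -1]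

/-- The matrices `α₁, α₂, α₃, α₄` (indexed by `0, 1, 2, 3`). -/
def alpha : Fin 4 → Mat4 :=
  ![!![0, 0, 0, -Complex.I; 0, 0, Complex.I, 0; 0, -Complex.I, 0, 0; Complex.I, 0, 0, 0],
    !![0, 0, 0, 1; 0, 0, 1, 0; 0, 1, 0, 0; 1, 0, 0, 0],
    !![0, 0, 1, 0; 0, 0, 0, -1; 1, 0, 0, 0; 0, -1, 0, 0],
    !![0, 0, Complex.I, 0; 0, 0, 0, Complex.I; -Complex.I, 0, 0, 0; 0, -Complex.I, 0, 0]]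

/-- The projection `I_uc = (β + I) / 2` onto the upper two components. -/
def Iuc : Mat4 := (1 / 2 : ℂ) • (beta + 1)

/-! ### The Dirac operator and distributional solutions -/

/-- `D_m η = -i ∑ₖ αₖ ∂ₖ η + m β η` for a differentiable spinor field `η`. -/
def freeDirac (m : ℝ) (η : R4 → C4) (x : R4) : C4 :=
  (-Complex.I) • (∑ k, act (alpha k) (fderiv ℝ η x (EuclideanSpace.single k 1)))
    + (m : ℂ) • act beta (η x)

/-- `ψ` solves `(D_m + V - m) ψ = 0` in the sense of distributions: the pairing of
`(D_m + V - m) ψ` with every test function vanishes, the formally self-adjoint operator `D_m - m`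
being moved onto the test function. -/
def IsDistributionalSolution (m : ℝ) (V : R4 → Mat4) (ψ : R4 → C4) : Prop :=
  LocallyIntegrable ψ volume ∧
  ∀ η : R4 → C4, ContDiff ℝ ∞ η → HasCompactSupport η →
    ∫ x, (inner ℂ (freeDirac m η x - (m : ℂ) • η x) (ψ x) + inner ℂ (η x) (act (V x) (ψ x))) = 0

/-- A threshold eigenfunction: a nonzero `L²` distributional solution of `(D_m + V - m) ψ = 0`. -/
def IsThresholdEigenfunction (m : ℝ) (V : R4 → Mat4) (ψ : R4 → C4) : Prop :=
  MemLp ψ 2 volume ∧ ¬ ψ =ᵐ[volume] 0 ∧ IsDistributionalSolution m V ψ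

/-! ### The factorization `V = v* U v` -/

/-- A measurable pointwise diagonalization `V = B* Λ B` of a self-adjoint matrix potential, with
`B` unitary and `Λ` the real diagonal matrix with entries `lam`. -/
structure Diagonalization (V : R4 → Mat4) where
  /-- the unitary matrices -/
  B : R4 → Mat4
  /-- the eigenvalues -/
  lam : R4 → Fin 4 → ℝ
  measurable_B : ∀ i j, Measurable fun x => B x i j
  measurable_lam : ∀ j, Measurable fun x => lam x j
  unitary : ∀ x, B x ∈ Matrix.unitaryGroup (Fin 4) ℂ
  eq : ∀ x, V x = (B x).conjTranspose * Matrix.diagonal (fun j => (lam x j : ℂ)) * B x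

/-- `v = |Λ|^{1/2} B`. -/
def Diagonalization.v {V : R4 → Mat4} (F : Diagonalization V) (x : R4) : Mat4 :=
  Matrix.diagonal (fun j => ((Real.sqrt |F.lam x j| : ℝ) : ℂ)) * F.B x

/-- The sign of a real number, with value `1` at `0` so that `U² = I` below. -/
def sgn (t : ℝ) : ℂ := if 0 ≤ t then 1 else -1

/-- `U = diag (sign λ₁, …, sign λ₄)`. -/
def Diagonalization.U {V : R4 → Mat4} (F : Diagonalization V) (x : R4) : Mat4 :=
  Matrix.diagonal (fun j => sgn (F.lam x j))

/-! ### Integral operators `v G v*` on `L²` -/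

/-- The function `v G v* f`, where `G` is the integral operator with matrix kernel `G x y`. -/
def sandwichFun (v : R4 → Mat4) (G : R4 → R4 → Mat4) (f : R4 → C4) (x : R4) : C4 :=
  act (v x) (∫ y, act (G x y) (act (v y).conjTranspose (f y)))

/-- The kernel of `𝒢₀ = (D_m + m) (-Δ)⁻¹ = (-i α·∇ + 2 m I_uc) (-Δ)⁻¹`, where `(-Δ)⁻¹` has the
kernel `1 / (4π² |x-y|²)`. -/
def kernelG0 (m : ℝ) (x y : R4) : Mat4 :=
  (Complex.I / ((2 * Real.pi ^ 2 * ‖x - y‖ ^ 4 : ℝ) : ℂ)) • (∑ k, ((x k - y k : ℝ) : ℂ) • alpha k)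
    + ((m / (2 * Real.pi ^ 2 * ‖x - y‖ ^ 2) : ℝ) : ℂ) • Iuc

/-- The kernel of `𝒢₁ = (m / 2π²) M_uc`. -/
def kernelG1 (m : ℝ) (_x _y : R4) : Mat4 := ((m / (2 * Real.pi ^ 2) : ℝ) : ℂ) • Iuc

/-- `M_uc f = ∫ I_uc f(y) dy`, a constant spinor. -/
def Muc (f : R4 → C4) : C4 := ∫ y, act Iuc (f y)

/-! ### Boundedness on `L²` of the operators `v G v*` for kernels `|G(x,y)| ≲ 1 + |x-y|⁻³` -/

lemma act_eq_sum (A : Mat4) (w : C4) :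
    act A w = ∑ i, ∑ j, (A i j * w j) • (EuclideanSpace.single i (1 : ℂ) : C4) := by
  ext k
  simp [act, Matrix.ofLp_toEuclideanCLM, Matrix.mulVec, dotProduct, Pi.single_apply,
    Finset.sum_apply]

lemma norm_act_le (A : Mat4) (w : C4) : ‖act A w‖ ≤ (∑ i, ∑ j, ‖A i j‖) * ‖w‖ := by
  rw [act_eq_sum, Finset.sum_mul]
  refine (norm_sum_le _ _).trans (Finset.sum_le_sum fun i _ => ?_)
  rw [Finset.sum_mul]
  refine (norm_sum_le _ _).trans (Finset.sum_le_sum fun j _ => ?_)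
  simp only [norm_smul, norm_mul, PiLp.norm_single, norm_one, mul_one]
  exact mul_le_mul_of_nonneg_left (PiLp.norm_apply_le w j) (norm_nonneg _)

lemma norm_act_le_of_bound {A : Mat4} {c : ℝ} (h : ∀ i j, ‖A i j‖ ≤ c) (w : C4) :
    ‖act A w‖ ≤ 16 * c * ‖w‖ := by
  refine (norm_act_le A w).trans (mul_le_mul_of_nonneg_right ?_ (norm_nonneg _))
  calc (∑ i, ∑ j, ‖A i j‖) ≤ ∑ _i : Fin 4, ∑ _j : Fin 4, c :=
        Finset.sum_le_sum fun i _ => Finset.sum_le_sum fun j _ => h i j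
    _ = 16 * c := by simp; ring

lemma aestronglyMeasurable_act {X : Type*} [MeasurableSpace X] {μ : Measure X} {A : X → Mat4}
    (hA : ∀ i j, Measurable fun x => A x i j) {f : X → C4} (hf : AEStronglyMeasurable f μ) :
    AEStronglyMeasurable (fun x => act (A x) (f x)) μ := by
  simp only [act_eq_sum]
  refine Finset.aestronglyMeasurable_fun_sum _ fun i _ =>
    Finset.aestronglyMeasurable_fun_sum _ fun j _ => ?_
  refine AEStronglyMeasurable.smul_const (AEStronglyMeasurable.mul
    (hA i j).aestronglyMeasurable ?_) _
  exact (EuclideanSpace.proj (𝕜 := ℂ) j : C4 →L[ℂ] ℂ).continuous.comp_aestronglyMeasurable hf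

lemma cauchySchwarz {X : Type*} [MeasurableSpace X] {μ : Measure X} {f g : X → ℝ≥0∞}
    (hf : AEMeasurable f μ) (hg : AEMeasurable g μ) :
    (∫⁻ a, f a * g a ∂μ) ^ 2 ≤ (∫⁻ a, f a ^ 2 ∂μ) * ∫⁻ a, g a ^ 2 ∂μ := by
  have h := ENNReal.lintegral_mul_le_Lp_mul_Lq μ Real.HolderConjugate.two_two hf hg
  have h2 := pow_le_pow_left₀ zero_le h 2
  rw [mul_pow, ← ENNReal.rpow_natCast (_ ^ _), ← ENNReal.rpow_natCast (_ ^ _),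
    ← ENNReal.rpow_mul, ← ENNReal.rpow_mul] at h2
  simpa using h2

lemma cauchySchwarz_weight {X : Type*} [MeasurableSpace X] {μ : Measure X} {n f : X → ℝ≥0∞}
    (hn : AEMeasurable n μ) (hf : AEMeasurable f μ) :
    (∫⁻ a, n a * f a ∂μ) ^ 2 ≤ (∫⁻ a, n a ∂μ) * ∫⁻ a, n a * f a ^ 2 ∂μ := by
  have hs : ∀ a, n a ^ (1 / 2 : ℝ) * n a ^ (1 / 2 : ℝ) = n a := fun a => by
    rw [← ENNReal.rpow_add_of_nonneg _ _ (by norm_num) (by norm_num)]; norm_num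
  have h := cauchySchwarz (μ := μ) (f := fun a => n a ^ (1 / 2 : ℝ))
    (g := fun a => n a ^ (1 / 2 : ℝ) * f a) (hn.pow_const _) ((hn.pow_const _).mul hf)
  have e1 : ∀ a, n a ^ (1 / 2 : ℝ) * (n a ^ (1 / 2 : ℝ) * f a) = n a * f a := fun a => by
    rw [← mul_assoc, hs]
  have e2 : ∀ a, (n a ^ (1 / 2 : ℝ) * f a) ^ 2 = n a * f a ^ 2 := fun a => by
    rw [mul_pow, pow_two (n a ^ (1 / 2 : ℝ)), hs]
  have e3 : ∀ a, (n a ^ (1 / 2 : ℝ)) ^ 2 = n a := fun a => by rw [pow_two, hs]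
  simpa only [e1, e2, e3] using h

/-- The truncated singularity `|z|⁻³` on the unit ball. -/
def nearKernel (z : R4) : ℝ≥0∞ :=
  (Metric.ball (0 : R4) 1).indicator (fun z => ENNReal.ofReal (‖z‖ ^ (-3 : ℝ))) z

lemma measurable_nearKernel : Measurable nearKernel :=
  Measurable.indicator (by fun_prop) measurableSet_ball

lemma lintegral_nearKernel_lt_top : ∫⁻ z, nearKernel z < ⊤ := by
  unfold nearKernel
  rw [lintegral_indicator measurableSet_ball]
  have h : IntegrableOn (fun z : R4 => ‖z‖ ^ (-3 : ℝ)) (Metric.ball 0 1) volume := by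
    refine integrableOn_ball_of_norm_le_rpow (C := 1) (α := 3) (by simp) (by simp; norm_num)
      (Eventually.of_forall fun z => ?_) (Measurable.aestronglyMeasurable (by fun_prop))
    rw [one_mul, Real.norm_of_nonneg (by positivity)]
  exact h.lintegral_lt_top

lemma one_add_le_nearKernel (z : R4) :
    ENNReal.ofReal (1 + ‖z‖ ^ (-3 : ℝ)) ≤ 2 + nearKernel z := by
  rw [ENNReal.ofReal_add zero_le_one (by positivity), ENNReal.ofReal_one]
  by_cases hz : z ∈ Metric.ball (0 : R4) 1
  · rw [nearKernel, Set.indicator_of_mem hz]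
    gcongr
    norm_num
  · rw [nearKernel, Set.indicator_of_notMem hz, add_zero]
    have h1 : 1 ≤ ‖z‖ := by simpa using hz
    have : ‖z‖ ^ (-3 : ℝ) ≤ 1 := Real.rpow_le_one_of_one_le_of_nonpos h1 (by norm_num)
    calc 1 + ENNReal.ofReal (‖z‖ ^ (-3 : ℝ)) ≤ 1 + ENNReal.ofReal 1 := by gcongr
      _ = 2 := by norm_num

lemma lintegral_near_sq_le {f : R4 → ℝ≥0∞} (hf : AEMeasurable f volume) :
    ∫⁻ x, (∫⁻ y, nearKernel (x - y) * f y) ^ 2 ≤ (∫⁻ z, nearKernel z) ^ 2 * ∫⁻ y, f y ^ 2 := by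
  have hm : ∀ x, Measurable fun y => nearKernel (x - y) := fun x =>
    measurable_nearKernel.comp (by fun_prop)
  have hm' : Measurable fun p : R4 × R4 => nearKernel (p.1 - p.2) :=
    measurable_nearKernel.comp (by fun_prop)
  calc ∫⁻ x, (∫⁻ y, nearKernel (x - y) * f y) ^ 2
      ≤ ∫⁻ x, (∫⁻ z, nearKernel z) * ∫⁻ y, nearKernel (x - y) * f y ^ 2 := by
        refine lintegral_mono fun x => ?_
        refine (cauchySchwarz_weight (hm x).aemeasurable hf).trans_eq ?_
        rw [lintegral_sub_left_eq_self nearKernel x]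
    _ = (∫⁻ z, nearKernel z) * ∫⁻ x, ∫⁻ y, nearKernel (x - y) * f y ^ 2 :=
        lintegral_const_mul' _ _ lintegral_nearKernel_lt_top.ne
    _ = (∫⁻ z, nearKernel z) * ∫⁻ y, ∫⁻ x, nearKernel (x - y) * f y ^ 2 := by
        rw [lintegral_lintegral_swap]
        exact hm'.aemeasurable.mul ((hf.pow_const 2).comp_quasiMeasurePreserving
          Measure.quasiMeasurePreserving_snd)
    _ = (∫⁻ z, nearKernel z) * ∫⁻ y, (∫⁻ z, nearKernel z) * f y ^ 2 := by
        congr 1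
        refine lintegral_congr fun y => ?_
        have hy : Measurable fun x => nearKernel (x - y) :=
          measurable_nearKernel.comp (by fun_prop)
        rw [lintegral_mul_const _ hy,
          lintegral_sub_right_eq_self nearKernel y]
    _ = (∫⁻ z, nearKernel z) ^ 2 * ∫⁻ y, f y ^ 2 := by
        rw [lintegral_const_mul' _ _ lintegral_nearKernel_lt_top.ne, pow_two, mul_assoc]

/-- The scalar operator that dominates `v G v*`. -/
def majorant (A f : R4 → ℝ≥0∞) (x : R4) : ℝ≥0∞ :=
  A x * ∫⁻ y, (2 + nearKernel (x - y)) * (A y * f y)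

lemma lintegral_majorant_sq_le {A f : R4 → ℝ≥0∞} {M : ℝ≥0∞} (hA : Measurable A)
    (hM : ∀ x, A x ≤ M) (hMt : M ≠ ⊤) (hf : AEMeasurable f volume) :
    ∫⁻ x, majorant A f x ^ 2 ≤
      (8 * (∫⁻ x, A x ^ 2) ^ 2 + 2 * M ^ 4 * (∫⁻ z, nearKernel z) ^ 2) * ∫⁻ y, f y ^ 2 := by
  have hm : ∀ x, Measurable fun y => nearKernel (x - y) := fun x =>
    measurable_nearKernel.comp (by fun_prop)
  have hpt : ∀ x, majorant A f x ^ 2 ≤ 8 * ((∫⁻ y, A y * f y) ^ 2 * A x ^ 2)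
      + 2 * M ^ 4 * (∫⁻ y, nearKernel (x - y) * f y) ^ 2 := by
    intro x
    have h1 : majorant A f x ≤ 2 * (A x * ∫⁻ y, A y * f y)
        + M ^ 2 * ∫⁻ y, nearKernel (x - y) * f y := by
      unfold majorant
      simp only [add_mul]
      have h0 : AEMeasurable (fun y => 2 * (A y * f y)) volume :=
        (hA.aemeasurable.mul hf).const_mul 2
      rw [lintegral_add_left' h0,
        lintegral_const_mul' _ _ (by norm_num), mul_add]
      refine add_le_add (le_of_eq (by ring)) ?_
      have h2 : ∫⁻ y, nearKernel (x - y) * (A y * f y) ≤ M * ∫⁻ y, nearKernel (x - y) * f y := by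
        rw [← lintegral_const_mul' _ _ hMt]
        refine lintegral_mono fun y => ?_
        calc nearKernel (x - y) * (A y * f y) ≤ nearKernel (x - y) * (M * f y) := by
              gcongr; exact hM y
          _ = M * (nearKernel (x - y) * f y) := by ring
      calc _ ≤ M * (M * ∫⁻ y, nearKernel (x - y) * f y) := mul_le_mul' (hM x) h2
        _ = _ := by ring
    have h3 : ∀ a b : ℝ≥0∞, (a + b) ^ 2 ≤ 2 * (a ^ 2 + b ^ 2) := fun a b => by
      have := ENNReal.rpow_add_le_mul_rpow_add_rpow a b (p := 2) (by norm_num)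
      norm_num at this
      exact this
    calc majorant A f x ^ 2 ≤ _ := pow_le_pow_left₀ zero_le h1 2
      _ ≤ _ := h3 _ _
      _ = _ := by ring
  calc ∫⁻ x, majorant A f x ^ 2 ≤ _ := lintegral_mono hpt
    _ = 8 * ((∫⁻ y, A y * f y) ^ 2 * ∫⁻ x, A x ^ 2)
        + 2 * M ^ 4 * ∫⁻ x, (∫⁻ y, nearKernel (x - y) * f y) ^ 2 := by
      rw [lintegral_add_left (((hA.pow_const 2).const_mul _).const_mul _),
        lintegral_const_mul _ ((hA.pow_const 2).const_mul _),
        lintegral_const_mul _ (hA.pow_const 2),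
        lintegral_const_mul' _ _ (ENNReal.mul_ne_top (by norm_num) (ENNReal.pow_ne_top hMt))]
    _ ≤ 8 * (((∫⁻ x, A x ^ 2) * ∫⁻ y, f y ^ 2) * ∫⁻ x, A x ^ 2)
        + 2 * M ^ 4 * ((∫⁻ z, nearKernel z) ^ 2 * ∫⁻ y, f y ^ 2) := by
      gcongr
      · exact cauchySchwarz hA.aemeasurable hf
      · exact lintegral_near_sq_le hf
    _ = _ := by ring

lemma bracket_pos (x : R4) : 0 < bracket x := Real.sqrt_pos.2 (by positivity)

lemma one_le_bracket (x : R4) : 1 ≤ bracket x :=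
  Real.one_le_sqrt.2 (by nlinarith [sq_nonneg ‖x‖])

lemma measurable_bracket : Measurable bracket := by
  unfold bracket
  fun_prop

lemma exists_weight {v : R4 → Mat4} (hv : DecaysFasterThan 2 v) :
    ∃ A : R4 → ℝ≥0∞, Measurable A ∧ (∀ x, A x ≠ 0) ∧ (∃ M : ℝ≥0∞, M ≠ ⊤ ∧ ∀ x, A x ≤ M) ∧
      ∫⁻ x, A x ^ 2 < ⊤ ∧ ∀ x w, ‖act (v x) w‖ₑ ≤ A x * ‖w‖ₑ ∧
        ‖act (v x).conjTranspose w‖ₑ ≤ A x * ‖w‖ₑ := by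
  obtain ⟨C, ε, hε, hC⟩ := hv
  set D : ℝ := 16 * (|C| + 1) with hD
  have hD0 : 0 < D := by positivity
  have hb : ∀ x, 0 < bracket x ^ (-(2 + ε)) := fun x => Real.rpow_pos_of_pos (bracket_pos x) _
  refine ⟨fun x => ENNReal.ofReal (D * bracket x ^ (-(2 + ε))), ?_, ?_, ?_, ?_, ?_⟩
  · exact ((measurable_bracket.pow_const _).const_mul _).ennreal_ofReal
  · intro x
    simpa using mul_pos hD0 (hb x)
  · refine ⟨ENNReal.ofReal D, ENNReal.ofReal_ne_top, fun x => ENNReal.ofReal_le_ofReal ?_⟩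
    exact mul_le_of_le_one_right hD0.le
      (Real.rpow_le_one_of_one_le_of_nonpos (one_le_bracket x) (by linarith))
  · have hi : Integrable (fun x : R4 => D ^ 2 * ((1 : ℝ) + ‖x‖ ^ 2) ^ (-(4 + 2 * ε) / 2)) volume :=
      (integrable_rpow_neg_one_add_norm_sq (by simp; linarith)).const_mul _
    refine lt_of_le_of_lt (lintegral_mono fun x => ?_) hi.lintegral_lt_top
    rw [← ENNReal.ofReal_pow (mul_pos hD0 (hb x)).le, mul_pow]
    refine ENNReal.ofReal_le_ofReal (le_of_eq ?_)
    congr 1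
    rw [bracket, Real.sqrt_eq_rpow, ← Real.rpow_mul (by positivity), ← Real.rpow_natCast,
      ← Real.rpow_mul (by positivity)]
    congr 1
    push_cast
    ring
  · intro x w
    have key : ∀ A : Mat4, (∀ i j, ‖A i j‖ ≤ C * bracket x ^ (-(2 + ε))) →
        ‖act A w‖ₑ ≤ ENNReal.ofReal (D * bracket x ^ (-(2 + ε))) * ‖w‖ₑ := by
      intro A hA
      rw [← ofReal_norm, ← ofReal_norm, ← ENNReal.ofReal_mul (mul_pos hD0 (hb x)).le]
      refine ENNReal.ofReal_le_ofReal ((norm_act_le_of_bound hA w).trans ?_)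
      refine mul_le_mul_of_nonneg_right ?_ (norm_nonneg _)
      rw [hD, ← mul_assoc]
      refine mul_le_mul_of_nonneg_right ?_ (hb x).le
      linarith [le_abs_self C]
    refine ⟨key _ (hC x), key _ fun i j => ?_⟩
    rw [Matrix.conjTranspose_apply, norm_star]
    exact hC x j i

/-- The bound `|G(x,y)| ≲ 1 + |x-y|⁻³` on the entries of a matrix kernel. -/
def KernelBound (G : R4 → R4 → Mat4) : Prop :=
  ∃ K : ℝ, ∀ x y i j, ‖G x y i j‖ ≤ K * (1 + ‖x - y‖ ^ (-3 : ℝ))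

/-- Joint measurability of the entries of a matrix kernel. -/
def KernelMeasurable (G : R4 → R4 → Mat4) : Prop :=
  ∀ i j, Measurable fun p : R4 × R4 => G p.1 p.2 i j

section sandwich

variable {v : R4 → Mat4} {G : R4 → R4 → Mat4}

lemma sandwich_integrand_aesm (hvm : ∀ i j, Measurable fun x => v x i j) (hG : KernelMeasurable G)
    {f : R4 → C4} (hf : AEStronglyMeasurable f volume) :
    AEStronglyMeasurable (fun p : R4 × R4 =>
      act (G p.1 p.2) (act (v p.2).conjTranspose (f p.2))) (volume.prod volume) := by
  refine aestronglyMeasurable_act hG ?_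
  have h1 : AEStronglyMeasurable (fun y => act (v y).conjTranspose (f y)) volume := by
    refine aestronglyMeasurable_act (fun i j => ?_) hf
    simp only [Matrix.conjTranspose_apply]
    exact continuous_star.measurable.comp (hvm j i)
  exact h1.comp_quasiMeasurePreserving Measure.quasiMeasurePreserving_snd

lemma sandwich_aesm (hvm : ∀ i j, Measurable fun x => v x i j) (hG : KernelMeasurable G)
    {f : R4 → C4} (hf : AEStronglyMeasurable f volume) :
    AEStronglyMeasurable (sandwichFun v G f) volume :=
  aestronglyMeasurable_act hvm (sandwich_integrand_aesm hvm hG hf).integral_prod_right'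

lemma sandwich_estimates (hvm : ∀ i j, Measurable fun x => v x i j) (hv : DecaysFasterThan 2 v)
    (hGm : KernelMeasurable G) (hG : KernelBound G) :
    ∃ L : ℝ≥0∞, L ≠ ⊤ ∧ ∀ f : R4 → C4, MemLp f 2 volume →
      eLpNorm (sandwichFun v G f) 2 volume ≤ L * eLpNorm f 2 volume ∧
      ∀ᵐ x, Integrable (fun y => act (G x y) (act (v y).conjTranspose (f y))) volume := by
  obtain ⟨A, hA, hA0, ⟨M, hMt, hM⟩, hA2, hact⟩ := exists_weight hv
  obtain ⟨K, hK⟩ := hG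
  set k : ℝ≥0∞ := ENNReal.ofReal (16 * |K|) with hk
  have hkt : k ≠ ⊤ := ENNReal.ofReal_ne_top
  have hGb : ∀ x y w, ‖act (G x y) w‖ₑ ≤ k * ((2 + nearKernel (x - y)) * ‖w‖ₑ) := by
    intro x y w
    have h1 : ∀ i j, ‖G x y i j‖ ≤ |K| * (1 + ‖x - y‖ ^ (-3 : ℝ)) := fun i j =>
      (hK x y i j).trans (mul_le_mul_of_nonneg_right (le_abs_self K) (by positivity))
    have h2 := norm_act_le_of_bound h1 w
    rw [← ofReal_norm]
    calc ENNReal.ofReal ‖act (G x y) w‖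
        ≤ ENNReal.ofReal ((16 * |K|) * ((1 + ‖x - y‖ ^ (-3 : ℝ)) * ‖w‖)) :=
          ENNReal.ofReal_le_ofReal (h2.trans_eq (by ring))
      _ = k * (ENNReal.ofReal (1 + ‖x - y‖ ^ (-3 : ℝ)) * ‖w‖ₑ) := by
          rw [ENNReal.ofReal_mul (p := 16 * |K|) (by positivity),
            ENNReal.ofReal_mul (p := 1 + ‖x - y‖ ^ (-3 : ℝ)) (by positivity), ofReal_norm]
      _ ≤ _ := by gcongr; exact one_add_le_nearKernel _
  have hint : ∀ (f : R4 → C4) x, ∫⁻ y, ‖act (G x y) (act (v y).conjTranspose (f y))‖ₑ ≤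
      k * ∫⁻ y, (2 + nearKernel (x - y)) * (A y * ‖f y‖ₑ) := by
    intro f x
    rw [← lintegral_const_mul' _ _ hkt]
    refine lintegral_mono fun y => (hGb x y _).trans ?_
    gcongr
    exact (hact y (f y)).2
  set S : ℝ≥0∞ := 8 * (∫⁻ x, A x ^ 2) ^ 2 + 2 * M ^ 4 * (∫⁻ z, nearKernel z) ^ 2 with hS
  have hSt : S ≠ ⊤ := by
    refine ENNReal.add_ne_top.2 ⟨ENNReal.mul_ne_top (by norm_num) (ENNReal.pow_ne_top hA2.ne),
      ENNReal.mul_ne_top (ENNReal.mul_ne_top (by norm_num) (ENNReal.pow_ne_top hMt))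
        (ENNReal.pow_ne_top lintegral_nearKernel_lt_top.ne)⟩
  refine ⟨k * S ^ (1 / 2 : ℝ),
    ENNReal.mul_ne_top hkt (ENNReal.rpow_ne_top_of_nonneg (by norm_num) hSt), fun f hf => ?_⟩
  have hfm : AEMeasurable (fun y => ‖f y‖ₑ) volume := hf.1.enorm
  have hmaj := lintegral_majorant_sq_le hA hM hMt hfm
  have hL2 : ∀ g : R4 → C4, eLpNorm g 2 volume = (∫⁻ x, ‖g x‖ₑ ^ 2) ^ (1 / 2 : ℝ) := fun g => by
    rw [eLpNorm_eq_lintegral_rpow_enorm_toReal (by norm_num) (by norm_num)]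
    simp
  have hft : ∫⁻ y, ‖f y‖ₑ ^ 2 < ⊤ := by
    have := hf.2
    rw [hL2] at this
    by_contra h
    rw [not_lt, top_le_iff] at h
    simp [h] at this
  constructor
  · have h1 : ∀ x, ‖sandwichFun v G f x‖ₑ ≤ k * majorant A (fun y => ‖f y‖ₑ) x := by
      intro x
      refine ((hact x _).1).trans ?_
      calc A x * ‖∫ y, act (G x y) (act (v y).conjTranspose (f y))‖ₑ
          ≤ A x * (k * ∫⁻ y, (2 + nearKernel (x - y)) * (A y * ‖f y‖ₑ)) := by
            gcongr
            exact (enorm_integral_le_lintegral_enorm _).trans (hint f x)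
        _ = _ := by rw [majorant]; ring
    rw [hL2, hL2]
    calc (∫⁻ x, ‖sandwichFun v G f x‖ₑ ^ 2) ^ (1 / 2 : ℝ)
        ≤ (k ^ 2 * (S * ∫⁻ y, ‖f y‖ₑ ^ 2)) ^ (1 / 2 : ℝ) := by
          refine ENNReal.rpow_le_rpow ?_ (by norm_num)
          calc ∫⁻ x, ‖sandwichFun v G f x‖ₑ ^ 2
              ≤ ∫⁻ x, k ^ 2 * majorant A (fun y => ‖f y‖ₑ) x ^ 2 := by
                refine lintegral_mono fun x => ?_
                rw [← mul_pow]
                exact pow_le_pow_left₀ zero_le (h1 x) 2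
            _ = k ^ 2 * ∫⁻ x, majorant A (fun y => ‖f y‖ₑ) x ^ 2 :=
                lintegral_const_mul' _ _ (ENNReal.pow_ne_top hkt)
            _ ≤ _ := by gcongr
      _ = k * S ^ (1 / 2 : ℝ) * (∫⁻ y, ‖f y‖ₑ ^ 2) ^ (1 / 2 : ℝ) := by
          rw [ENNReal.mul_rpow_of_nonneg _ _ (by norm_num),
            ENNReal.mul_rpow_of_nonneg _ _ (by norm_num), ← ENNReal.rpow_natCast,
            ← ENNReal.rpow_mul]
          norm_num [mul_assoc]
  · have hpm : AEMeasurable (fun x => majorant A (fun y => ‖f y‖ₑ) x ^ 2) volume := by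
      refine AEMeasurable.pow_const (hA.aemeasurable.mul ?_) 2
      have : AEMeasurable (fun p : R4 × R4 =>
          (2 + nearKernel (p.1 - p.2)) * (A p.2 * ‖f p.2‖ₑ)) (volume.prod volume) := by
        refine AEMeasurable.mul (Measurable.aemeasurable (measurable_const.add
          (measurable_nearKernel.comp (by fun_prop)))) ?_
        exact (hA.aemeasurable.mul hfm).comp_quasiMeasurePreserving
          Measure.quasiMeasurePreserving_snd
      exact this.lintegral_prod_right'
    have hfin := ae_lt_top' hpm
      (lt_of_le_of_lt hmaj (ENNReal.mul_lt_top hSt.lt_top hft)).ne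
    filter_upwards [hfin, (sandwich_integrand_aesm hvm hGm hf.1).prodMk_left] with x hx hxm
    refine ⟨hxm, lt_of_le_of_lt (hint f x) (ENNReal.mul_lt_top hkt.lt_top ?_)⟩
    by_contra h
    rw [not_lt, top_le_iff] at h
    rw [majorant, h, ENNReal.mul_top (hA0 x)] at hx
    simp at hx

lemma sandwich_memLp (hvm : ∀ i j, Measurable fun x => v x i j) (hv : DecaysFasterThan 2 v)
    (hGm : KernelMeasurable G) (hG : KernelBound G) {f : R4 → C4} (hf : MemLp f 2 volume) :
    MemLp (sandwichFun v G f) 2 volume := by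
  obtain ⟨L, hL, h⟩ := sandwich_estimates hvm hv hGm hG
  exact ⟨sandwich_aesm hvm hGm hf.1,
    lt_of_le_of_lt (h f hf).1 (ENNReal.mul_lt_top hL.lt_top hf.2)⟩

lemma sandwich_congr {f g : R4 → C4} (h : f =ᵐ[volume] g) :
    sandwichFun v G f = sandwichFun v G g := by
  funext x
  unfold sandwichFun
  congr 1
  refine integral_congr_ae ?_
  filter_upwards [h] with y hy
  rw [hy]

lemma sandwich_add (hvm : ∀ i j, Measurable fun x => v x i j) (hv : DecaysFasterThan 2 v)
    (hGm : KernelMeasurable G) (hG : KernelBound G) {f g : R4 → C4} (hf : MemLp f 2 volume)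
    (hg : MemLp g 2 volume) :
    sandwichFun v G (f + g) =ᵐ[volume] sandwichFun v G f + sandwichFun v G g := by
  obtain ⟨L, hL, h⟩ := sandwich_estimates hvm hv hGm hG
  filter_upwards [(h f hf).2, (h g hg).2] with x h1 h2
  simp only [sandwichFun, Pi.add_apply, map_add]
  rw [integral_add h1 h2, map_add]

lemma sandwich_smul (c : ℂ) (f : R4 → C4) :
    sandwichFun v G (c • f) = c • sandwichFun v G f := by
  funext x
  simp only [sandwichFun, Pi.smul_apply, map_smul, integral_smul]

end sandwich

/-- The operator `v G v*` on `L²(ℝ⁴)`, as a linear map. -/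
def sandwichLinear (v : R4 → Mat4) (G : R4 → R4 → Mat4) (hvm : ∀ i j, Measurable fun x => v x i j)
    (hv : DecaysFasterThan 2 v) (hGm : KernelMeasurable G) (hG : KernelBound G) : L2 →ₗ[ℂ] L2 where
  toFun φ := (sandwich_memLp hvm hv hGm hG (Lp.memLp φ)).toLp (sandwichFun v G φ)
  map_add' φ χ := by
    rw [← MemLp.toLp_add, MemLp.toLp_eq_toLp_iff, sandwich_congr (Lp.coeFn_add φ χ)]
    exact sandwich_add hvm hv hGm hG (Lp.memLp φ) (Lp.memLp χ)
  map_smul' c φ := by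
    rw [RingHom.id_apply, ← MemLp.toLp_const_smul, MemLp.toLp_eq_toLp_iff,
      sandwich_congr (Lp.coeFn_smul c φ), sandwich_smul]

lemma sandwichLinear_bound (v : R4 → Mat4) (G : R4 → R4 → Mat4)
    (hvm : ∀ i j, Measurable fun x => v x i j)
    (hv : DecaysFasterThan 2 v) (hGm : KernelMeasurable G) (hG : KernelBound G) :
    ∃ C : ℝ, ∀ φ : L2, ‖sandwichLinear v G hvm hv hGm hG φ‖ ≤ C * ‖φ‖ := by
  obtain ⟨L, hL, h⟩ := sandwich_estimates hvm hv hGm hG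
  refine ⟨L.toReal, fun φ => ?_⟩
  have h1 : ‖sandwichLinear v G hvm hv hGm hG φ‖
      = (eLpNorm (sandwichFun v G φ) 2 volume).toReal :=
    Lp.norm_toLp _ (sandwich_memLp hvm hv hGm hG (Lp.memLp φ))
  rw [h1, Lp.norm_def, ← ENNReal.toReal_mul]
  exact ENNReal.toReal_mono (ENNReal.mul_ne_top hL (Lp.memLp φ).2.ne) (h φ (Lp.memLp φ)).1

/-- The bounded operator `v G v*` on `L²(ℝ⁴)`. -/
def sandwich (v : R4 → Mat4) (G : R4 → R4 → Mat4) (hvm : ∀ i j, Measurable fun x => v x i j)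
    (hv : DecaysFasterThan 2 v) (hGm : KernelMeasurable G) (hG : KernelBound G) : L2 →L[ℂ] L2 :=
  (sandwichLinear v G hvm hv hGm hG).mkContinuousOfExistsBound
    (sandwichLinear_bound v G hvm hv hGm hG)

/-! ### Multiplication by a bounded matrix function -/

lemma act_memLp {A : R4 → Mat4} (hm : ∀ i j, Measurable fun x => A x i j) {C : ℝ}
    (hb : ∀ x i j, ‖A x i j‖ ≤ C) {f : R4 → C4} (hf : MemLp f 2 volume) :
    MemLp (fun x => act (A x) (f x)) 2 volume :=
  hf.of_le_mul (aestronglyMeasurable_act hm hf.1)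
    (Eventually.of_forall fun x => norm_act_le_of_bound (hb x) (f x))

/-- The linear map on `L²(ℝ⁴)` of multiplication by a bounded matrix function. -/
def mulLinear (A : R4 → Mat4) (hm : ∀ i j, Measurable fun x => A x i j) (C : ℝ)
    (hb : ∀ x i j, ‖A x i j‖ ≤ C) : L2 →ₗ[ℂ] L2 where
  toFun φ := (act_memLp hm hb (Lp.memLp φ)).toLp (fun x => act (A x) (φ x))
  map_add' φ χ := by
    rw [← MemLp.toLp_add, MemLp.toLp_eq_toLp_iff]
    filter_upwards [Lp.coeFn_add φ χ] with x hx
    rw [hx, Pi.add_apply, Pi.add_apply, map_add]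
  map_smul' c φ := by
    rw [RingHom.id_apply, ← MemLp.toLp_const_smul, MemLp.toLp_eq_toLp_iff]
    filter_upwards [Lp.coeFn_smul c φ] with x hx
    rw [hx, Pi.smul_apply, Pi.smul_apply, map_smul]

/-- The bounded operator on `L²(ℝ⁴)` of multiplication by a bounded matrix function. -/
def mulOp (A : R4 → Mat4) (hm : ∀ i j, Measurable fun x => A x i j) (C : ℝ)
    (hb : ∀ x i j, ‖A x i j‖ ≤ C) : L2 →L[ℂ] L2 :=
  (mulLinear A hm C hb).mkContinuous (16 * C) fun φ => by
    refine Lp.norm_le_mul_norm_of_ae_le_mul ?_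
    filter_upwards [MemLp.coeFn_toLp (act_memLp hm hb (Lp.memLp φ))] with x hx
    change ‖(act_memLp hm hb (Lp.memLp φ)).toLp (fun x => act (A x) (φ x)) x‖ ≤ _
    rw [hx]
    exact norm_act_le_of_bound (hb x) (φ x)

/-! ### The operators `T₀`, `T₁` and the threshold subspaces -/

lemma Diagonalization.measurable_v {V : R4 → Mat4} (F : Diagonalization V) (i j : Fin 4) :
    Measurable fun x => F.v x i j := by
  simp only [Diagonalization.v, Matrix.diagonal_mul]
  exact (Complex.measurable_ofReal.comp (F.measurable_lam i).abs.sqrt).mul (F.measurable_B i j)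

lemma Diagonalization.measurable_U {V : R4 → Mat4} (F : Diagonalization V) (i j : Fin 4) :
    Measurable fun x => F.U x i j := by
  simp only [Diagonalization.U, Matrix.diagonal_apply, sgn]
  split_ifs
  · exact Measurable.ite (measurableSet_le measurable_const (F.measurable_lam i))
      measurable_const measurable_const
  · exact measurable_const

lemma Diagonalization.norm_U_le {V : R4 → Mat4} (F : Diagonalization V) (x : R4) (i j : Fin 4) :
    ‖F.U x i j‖ ≤ 1 := by
  simp only [Diagonalization.U, Matrix.diagonal_apply, sgn]
  split_ifs <;> simp

lemma measurable_kernelG0 (m : ℝ) : KernelMeasurable (kernelG0 m) := by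
  intro i j
  simp only [kernelG0, Matrix.add_apply, Matrix.smul_apply, Matrix.sum_apply, smul_eq_mul]
  fun_prop

lemma measurable_kernelG1 (m : ℝ) : KernelMeasurable (kernelG1 m) := fun _ _ => measurable_const

lemma norm_alpha_le (k i j : Fin 4) : ‖alpha k i j‖ ≤ 1 := by
  fin_cases k <;> fin_cases i <;> fin_cases j <;> simp [alpha]

lemma norm_Iuc_le (i j : Fin 4) : ‖Iuc i j‖ ≤ 1 := by
  fin_cases i <;> fin_cases j <;> norm_num [Iuc, beta]

lemma kernelBound_G0 (m : ℝ) : KernelBound (kernelG0 m) := by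
  refine ⟨4 + |m|, fun x y i j => ?_⟩
  set r := ‖x - y‖ with hr
  have hr0 : 0 ≤ r := norm_nonneg _
  have hpi : (1 : ℝ) ≤ 2 * Real.pi ^ 2 := by nlinarith [Real.pi_gt_three]
  rcases hr0.eq_or_lt with h0 | h0
  · have : kernelG0 m x y = 0 := by
      rw [kernelG0, ← hr, ← h0]
      simp
    rw [this, ← h0]
    simp
    positivity
  have h3 : r ^ (-3 : ℝ) = (r ^ 3)⁻¹ := by
    rw [Real.rpow_neg hr0, ← Real.rpow_natCast]
    norm_num
  have h2 : (r ^ 2)⁻¹ ≤ 1 + (r ^ 3)⁻¹ := by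
    rcases le_or_gt r 1 with h | h
    · have : (r ^ 2)⁻¹ ≤ (r ^ 3)⁻¹ :=
        inv_anti₀ (by positivity) (pow_le_pow_of_le_one hr0 h (by norm_num))
      linarith
    · have : (r ^ 2)⁻¹ ≤ 1 := inv_le_one_of_one_le₀ (one_le_pow₀ h.le)
      have : 0 ≤ (r ^ 3)⁻¹ := by positivity
      linarith
  have hsum : ‖∑ k, ((x k - y k : ℝ) : ℂ) * alpha k i j‖ ≤ 4 * r := by
    refine (norm_sum_le _ _).trans ?_
    calc ∑ k, ‖((x k - y k : ℝ) : ℂ) * alpha k i j‖ ≤ ∑ _k : Fin 4, r := by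
          refine Finset.sum_le_sum fun k _ => ?_
          rw [norm_mul, Complex.norm_real]
          calc _ ≤ ‖x k - y k‖ * 1 :=
                mul_le_mul_of_nonneg_left (norm_alpha_le k i j) (norm_nonneg _)
            _ ≤ r := by rw [mul_one]; exact PiLp.norm_apply_le (x - y) k
      _ = 4 * r := by simp
  have hterm1 : ‖(Complex.I / ((2 * Real.pi ^ 2 * r ^ 4 : ℝ) : ℂ)) *
      ∑ k, ((x k - y k : ℝ) : ℂ) * alpha k i j‖ ≤ 4 * (r ^ 3)⁻¹ := by
    rw [norm_mul, norm_div, Complex.norm_I, Complex.norm_real,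
      Real.norm_of_nonneg (by positivity)]
    calc 1 / (2 * Real.pi ^ 2 * r ^ 4) * _ ≤ 1 / (1 * r ^ 4) * (4 * r) := by gcongr
      _ = 4 * (r ^ 3)⁻¹ := by field_simp
  have hterm2 : ‖((m / (2 * Real.pi ^ 2 * r ^ 2) : ℝ) : ℂ) * Iuc i j‖
      ≤ |m| * (1 + (r ^ 3)⁻¹) := by
    rw [norm_mul, Complex.norm_real, norm_div, Real.norm_of_nonneg (by positivity : 0 ≤
      2 * Real.pi ^ 2 * r ^ 2), Real.norm_eq_abs]
    calc |m| / (2 * Real.pi ^ 2 * r ^ 2) * ‖Iuc i j‖ ≤ |m| / (1 * r ^ 2) * 1 := by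
          gcongr
          exact norm_Iuc_le i j
      _ = |m| * (r ^ 2)⁻¹ := by rw [one_mul, mul_one, div_eq_mul_inv]
      _ ≤ _ := by gcongr
  simp only [kernelG0, Matrix.add_apply, Matrix.smul_apply, Matrix.sum_apply, smul_eq_mul]
  rw [← hr, h3]
  have : 0 ≤ (r ^ 3)⁻¹ := by positivity
  refine (norm_add_le _ _).trans ((add_le_add hterm1 hterm2).trans ?_)
  nlinarith [abs_nonneg m]

lemma kernelBound_G1 (m : ℝ) : KernelBound (kernelG1 m) := by
  refine ⟨|m / (2 * Real.pi ^ 2)|, fun x y i j => ?_⟩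
  simp only [kernelG1, Matrix.smul_apply, smul_eq_mul]
  rw [norm_mul, Complex.norm_real, Real.norm_eq_abs]
  refine mul_le_mul_of_nonneg_left ((norm_Iuc_le i j).trans ?_) (abs_nonneg _)
  have : 0 ≤ ‖x - y‖ ^ (-3 : ℝ) := by positivity
  linarith

section threshold

variable {V : R4 → Mat4} (m : ℝ) (F : Diagonalization V) (hv : DecaysFasterThan 2 F.v)

/-- `T₀ = U + v 𝒢₀ v*` on `L²(ℝ⁴)`. -/
def T0 : L2 →L[ℂ] L2 :=
  mulOp F.U F.measurable_U 1 F.norm_U_le +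
    sandwich F.v (kernelG0 m) F.measurable_v hv (measurable_kernelG0 m) (kernelBound_G0 m)

/-- `T₁ = v 𝒢₁ v*` on `L²(ℝ⁴)`. -/
def T1 : L2 →L[ℂ] L2 :=
  sandwich F.v (kernelG1 m) F.measurable_v hv (measurable_kernelG1 m) (kernelBound_G1 m)

/-- `S₁L²`, the kernel of `T₀`. -/
def S1L2 : Submodule ℂ L2 := (T0 m F hv).ker

instance completeSpace_S1L2 : CompleteSpace (S1L2 m F hv) :=
  inferInstanceAs (CompleteSpace (T0 m F hv).ker)

/-- `S₁`, the orthogonal projection onto the kernel of `T₀`. -/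
def S1 : L2 →L[ℂ] L2 := (S1L2 m F hv).starProjection

/-- `S₂L²`, the kernel of `S₁ T₁ S₁` as an operator on `S₁L²`. -/
def S2L2 : Submodule ℂ L2 :=
  S1L2 m F hv ⊓ (S1 m F hv ∘L T1 m F hv ∘L S1 m F hv).ker

end threshold

end

end Dirac4

namespace Dirac4

noncomputable section

/-! Everything rests on the integral equation `ψ = -𝒢₀ V ψ` a.e., which is derived from the
distributional equation and the weight `⟨x⟩⁻¹ψ ∈ L²` alone (`IsDistributionalSolution.ae_eq`). The
Clifford relations give `(D_m - m)(D_m + m) = -Δ`, so `𝒢₀` is a fundamental solution of `D_m - m`.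
Its kernel is too singular to serve as a test function. It is therefore replaced by `(D_m + m)`
applied to `1 / (4π²(|z|² + ε))`, which is smooth and whose image under `D_m - m` is an explicit
approximate identity (`freeDirac_regKernel`). Testing a cut-off `ψ` against this kernel and letting
`ε → 0` yields the equation with a commutator error. The error lives on the annulus `R ≤ |x| ≤ 2R`
and vanishes as `R → ∞` because `⟨x⟩⁻¹ψ` is square integrable (`tendsto_integral_commTerm`).

At infinity `𝒢₀ g = (m/2π²) ⟨x⟩⁻² M_uc g` up to an `L²` error as soon as `g ∈ L²` and `⟨x⟩ g ∈ L¹`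
(`memLp_kernelG0_sub`), and the decay of `V` gives this for `g = Vψ`. In dimension four `⟨x⟩⁻²` just
fails to be square integrable, so `ψ ∈ L²` exactly when `M_uc Vψ = 0` (`memLp_iff_Muc_eq_zero`).
Since `Vψ = v*φ`, this is condition (d). On the operator side `⟨T₁φ, φ⟩ = (m/2π²)|M_uc v*φ|²`, so
for `φ ∈ S₁L²` membership in `S₂L²` is condition (d) as well (`mem_S2L2_iff`).

For boundedness, the singularity of `𝒢₀` splits into a bounded part and a part of small `L¹` norm.
The bounded part acting on `Vψ ∈ L¹` gives a constant, and the small part is absorbed by a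
contraction argument in `L²` (`ae_le_of_le_add_conv`). -/

/-! ### The regularized fundamental solution of `D_m - m` -/

/-- The kernel `(D_m + m) (1 / (4π² (|z|² + ε)))`, a regularization of the kernel of `𝒢₀`. -/
def regKernel (m ε : ℝ) (z : R4) : Mat4 :=
  (Complex.I / ((2 * Real.pi ^ 2 * (‖z‖ ^ 2 + ε) ^ 2 : ℝ) : ℂ)) • (∑ k, ((z k : ℝ) : ℂ) • alpha k)
    + ((m / (2 * Real.pi ^ 2 * (‖z‖ ^ 2 + ε)) : ℝ) : ℂ) • Iuc

/-- The approximate identity `-Δ (1 / (4π² (|z|² + ε)))`. -/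
def regDelta (ε : ℝ) (z : R4) : ℝ := 2 * ε / (Real.pi ^ 2 * (‖z‖ ^ 2 + ε) ^ 3)

lemma regKernel_zero (m : ℝ) (x y : R4) : regKernel m 0 (x - y) = kernelG0 m x y := by
  simp only [regKernel, kernelG0, add_zero, ← pow_mul, PiLp.sub_apply]

/-- With the coefficients as real scalars in front of fixed spinors, the real derivative in
`freeDirac` falls on scalar functions only. -/
lemma regKernel_act (m ε : ℝ) (z : R4) (c : C4) :
    act (regKernel m ε z) c =
      (∑ l, ((2 * Real.pi ^ 2 * (‖z‖ ^ 2 + ε) ^ 2)⁻¹ * z l) • (Complex.I • act (alpha l) c)) +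
      (m * (2 * Real.pi ^ 2 * (‖z‖ ^ 2 + ε))⁻¹) • act Iuc c := by
  simp only [regKernel, act, map_add, map_smul, map_sum, add_apply,
    smul_apply, sum_apply, Finset.smul_sum,
    ← Complex.coe_smul, smul_smul, div_eq_mul_inv]
  congr 1
  refine Finset.sum_congr rfl fun l _ => ?_
  push_cast
  congr 1
  ring

lemma normSq_pos {ε : ℝ} (hε : 0 < ε) (z : R4) : 0 < ‖z‖ ^ 2 + ε := by positivity

lemma hasFDerivAt_normSq (y x : R4) (ε : ℝ) :
    HasFDerivAt (fun x : R4 => ‖x - y‖ ^ 2 + ε) ((2 : ℝ) • innerSL ℝ (x - y)) x := by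
  have h := ((hasFDerivAt_id x).sub_const y).norm_sq.add_const ε
  refine h.congr_fderiv ?_
  ext v
  simp

lemma contDiff_regKernel_act (m : ℝ) {ε : ℝ} (hε : 0 < ε) (y : R4) (c : C4) :
    ContDiff ℝ ∞ fun x => act (regKernel m ε (x - y)) c := by
  simp only [regKernel_act]
  have h1 : ContDiff ℝ ∞ fun x : R4 => ‖x - y‖ ^ 2 + ε :=
    ((contDiff_id.sub contDiff_const).norm_sq ℝ).add contDiff_const
  have h2 : ∀ l, ContDiff ℝ ∞ fun x : R4 => (x - y) l := fun l => by
    simp only [PiLp.sub_apply]; fun_prop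
  refine ContDiff.add (ContDiff.sum fun l _ => ContDiff.smul (ContDiff.mul
    (ContDiff.inv (contDiff_const.mul (h1.pow 2)) fun x => ?_) (h2 l)) contDiff_const)
    (ContDiff.smul (contDiff_const.mul (ContDiff.inv (contDiff_const.mul h1) fun x => ?_))
    contDiff_const)
  · have := normSq_pos hε (x - y); positivity
  · have := normSq_pos hε (x - y); positivity

/-- The result is polynomial in `z = x - y` and in the single inverse `(‖z‖² + ε)⁻¹`, the form in
which the Dirac operator can be evaluated by ring arithmetic. -/
lemma fderiv_regKernel_act (m : ℝ) {ε : ℝ} (hε : 0 < ε) (y x : R4) (c : C4) (k : Fin 4) :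
    fderiv ℝ (fun x => act (regKernel m ε (x - y)) c) x (EuclideanSpace.single k 1) =
      (∑ l, ((2 * Real.pi ^ 2)⁻¹ * ((‖x - y‖ ^ 2 + ε)⁻¹ ^ 2 * (if k = l then 1 else 0)
        - 4 * (x - y) k * (x - y) l * (‖x - y‖ ^ 2 + ε)⁻¹ ^ 3)) • (Complex.I • act (alpha l) c)) +
      (-(m * (2 * Real.pi ^ 2)⁻¹ * (2 * (x - y) k * (‖x - y‖ ^ 2 + ε)⁻¹ ^ 2))) • act Iuc c := by
  have hD := normSq_pos hε (x - y)
  have h1 := hasFDerivAt_normSq y x ε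
  have hl : ∀ l, HasFDerivAt (fun x : R4 => (x - y) l) (EuclideanSpace.proj l : R4 →L[ℝ] ℝ) x :=
    fun l => by
      simp only [PiLp.sub_apply]
      exact (EuclideanSpace.proj l : R4 →L[ℝ] ℝ).hasFDerivAt.sub_const _
  have ha : HasFDerivAt (fun x : R4 => (2 * Real.pi ^ 2 * (‖x - y‖ ^ 2 + ε) ^ 2)⁻¹) _ x :=
    (hasDerivAt_inv (by positivity)).comp_hasFDerivAt x ((h1.pow 2).const_mul (2 * Real.pi ^ 2))
  have hb : HasFDerivAt (fun x : R4 => (2 * Real.pi ^ 2 * (‖x - y‖ ^ 2 + ε))⁻¹) _ x :=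
    (hasDerivAt_inv (by positivity)).comp_hasFDerivAt x (h1.const_mul (2 * Real.pi ^ 2))
  have h := (HasFDerivAt.fun_sum (u := Finset.univ) fun l _ =>
    (ha.fun_mul (hl l)).smul_const (Complex.I • act (alpha l) c)).fun_add
      ((hb.const_mul m).smul_const (act Iuc c))
  simp only [regKernel_act]
  rw [HasFDerivAt.fderiv h]
  have hpi := Real.pi_pos
  have hproj : ∀ l, (EuclideanSpace.proj l : R4 →L[ℝ] ℝ) (EuclideanSpace.single k 1)
      = if k = l then 1 else 0 := fun l => by
    simp [eq_comm]
  simp only [add_apply, sum_apply, ContinuousLinearMap.smulRight_apply, smul_apply, smul_eq_mul,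
    innerSL_apply_apply, hproj, EuclideanSpace.inner_single_right]
  congr 1
  · refine Finset.sum_congr rfl fun l _ => ?_
    congr 1
    split_ifs <;> simp <;> field_simp <;> ring
  · congr 1
    simp
    field_simp

-- By the Clifford relations `(D_m - m)(D_m + m) = -Δ`, and in dimension four `-Δ` of `1 / (4π²(|z|²
-- + ε))` is `2ε / (π²(|z|² + ε)³)`. The proof checks this componentwise.
set_option maxHeartbeats 1000000 in
lemma freeDirac_regKernel (m : ℝ) {ε : ℝ} (hε : 0 < ε) (y x : R4) (c : C4) :
    freeDirac m (fun x => act (regKernel m ε (x - y)) c) x - (m : ℂ) • act (regKernel m ε (x - y)) c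
      = regDelta ε (x - y) • c := by
  have hD := normSq_pos hε (x - y)
  have hs : ‖x - y‖ ^ 2 = ∑ k, (x - y) k ^ 2 := by
    simp [EuclideanSpace.norm_sq_eq]
  simp only [freeDirac, fderiv_regKernel_act m hε]
  simp only [regKernel_act, regDelta]
  have hpD : (‖x - y‖ ^ 2 + ε) * (‖x - y‖ ^ 2 + ε)⁻¹ = 1 := mul_inv_cancel₀ hD.ne'
  simp only [mul_inv, div_eq_mul_inv, ← inv_pow]
  -- From here on the only fact kept about `p` is `(|z|² + ε) p = 1`. Each component becomes a
  -- polynomial identity in `p`, `π⁻¹`, `z` and `c`, and is a multiple of that relation.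
  generalize (‖x - y‖ ^ 2 + ε)⁻¹ = p at hpD ⊢
  rw [hs] at hpD
  have hpD' := congrArg (fun t : ℝ => (t : ℂ)) hpD
  generalize Real.pi⁻¹ = q
  generalize x - y = z at hpD' ⊢
  simp only [Fin.sum_univ_four, Complex.ofReal_mul, Complex.ofReal_add, Complex.ofReal_pow,
    Complex.ofReal_one] at hpD'
  have hI := Complex.I_sq
  have hI4 := Complex.I_pow_four
  ext i
  fin_cases i <;>
    simp [Fin.sum_univ_four, act, alpha, beta, Iuc, Matrix.ofLp_toEuclideanCLM, Matrix.mulVec,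
      dotProduct] <;> ring_nf <;> simp only [hI, hI4]
  · linear_combination (-2 * (q : ℂ) ^ 2 * p ^ 2 * c 0) * hpD'
  · linear_combination (-2 * (q : ℂ) ^ 2 * p ^ 2 * c 1) * hpD'
  · linear_combination (-2 * (q : ℂ) ^ 2 * p ^ 2 * c 2) * hpD'
  · linear_combination (-2 * (q : ℂ) ^ 2 * p ^ 2 * c 3) * hpD'

/-! ### The approximate identity `regDelta` -/

lemma regDelta_nonneg {ε : ℝ} (hε : 0 ≤ ε) (z : R4) : 0 ≤ regDelta ε z := by
  unfold regDelta; positivity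

lemma continuous_regDelta {ε : ℝ} (hε : 0 < ε) : Continuous (regDelta ε) := by
  unfold regDelta
  refine continuous_const.div (by fun_prop) fun z => ?_
  have := Real.pi_pos
  have := normSq_pos hε z
  positivity

lemma regDelta_le {ε : ℝ} (hε : 0 < ε) (z : R4) : regDelta ε z ≤ 2 * ε / (Real.pi ^ 2 * ε ^ 3) := by
  unfold regDelta
  have := Real.pi_pos
  gcongr
  nlinarith [sq_nonneg ‖z‖]

/-- The factor `s⁻⁴` is the Jacobian of a dilation of `ℝ⁴`, so `regDelta (s²)` is the
`L¹`-normalized dilate of `regDelta 1`. This is why `ε` is later taken to be a square. -/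
lemma regDelta_scale {s : ℝ} (hs : 0 < s) (z : R4) :
    regDelta (s ^ 2) (s • z) = (s ^ 4)⁻¹ * regDelta 1 z := by
  unfold regDelta
  have := Real.pi_pos
  have h1 : (‖s • z‖ ^ 2 + s ^ 2) = s ^ 2 * (‖z‖ ^ 2 + 1) := by
    rw [norm_smul, Real.norm_of_nonneg hs.le]; ring
  rw [h1]
  field_simp

lemma hasDerivAt_radial (r : ℝ) :
    HasDerivAt (fun r : ℝ => r ^ 4 / (4 * (r ^ 2 + 1) ^ 2)) (r ^ 3 / (r ^ 2 + 1) ^ 3) r := by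
  have h := (hasDerivAt_pow 4 r).div ((((hasDerivAt_pow 2 r).add_const 1).pow 2).const_mul 4)
    (by change 4 * (r ^ 2 + 1) ^ 2 ≠ 0; positivity)
  refine h.congr_deriv ?_
  simp
  field_simp
  ring

lemma tendsto_radial :
    Tendsto (fun r : ℝ => r ^ 4 / (4 * (r ^ 2 + 1) ^ 2)) atTop (nhds (1 / 4)) := by
  have h : Tendsto (fun r : ℝ => (1 / 4) * (1 - (r ^ 2 + 1)⁻¹) ^ 2) atTop
      (nhds ((1 / 4) * (1 - 0) ^ 2)) := by
    refine Tendsto.const_mul _ (Tendsto.pow (Tendsto.const_sub _ ?_) 2)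
    exact tendsto_inv_atTop_zero.comp
      (tendsto_atTop_add_const_right _ _ (tendsto_pow_atTop two_ne_zero))
  norm_num at h
  refine h.congr fun r => ?_
  field_simp
  ring

lemma integrable_regDelta_one : Integrable (regDelta 1) volume := by
  have hi : Integrable (fun x : R4 => 2 / Real.pi ^ 2 * ((1 : ℝ) + ‖x‖ ^ 2) ^ (-6 / 2 : ℝ)) volume :=
    (integrable_rpow_neg_one_add_norm_sq (by simp; norm_num)).const_mul _
  refine hi.congr (Eventually.of_forall fun x => ?_)
  simp only [regDelta]
  rw [show (-6 / 2 : ℝ) = -((3 : ℕ) : ℝ) by norm_num, Real.rpow_neg (by positivity),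
    Real.rpow_natCast, add_comm]
  have := Real.pi_pos
  field_simp

/-- In polar coordinates the mass is `4 · |B₁| · (2/π²) · ∫ r³/(r²+1)³ dr` with `|B₁| = π²/2`. The
radial integral is `1/4`, from the primitive in `hasDerivAt_radial`. -/
lemma integral_regDelta_one : ∫ z, regDelta 1 z = 1 := by
  have h := integral_fun_norm_addHaar (volume : Measure R4)
    (fun r : ℝ => 2 / (Real.pi ^ 2 * (r ^ 2 + 1) ^ 3))
  have hpi := Real.pi_pos
  have hint : ∫ r in Set.Ioi (0 : ℝ), r ^ 3 / (r ^ 2 + 1) ^ 3 = 1 / 4 := by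
    rw [integral_Ioi_of_hasDerivAt_of_nonneg' (fun r _ => hasDerivAt_radial r)
      (fun r hr => by have : (0:ℝ) < r := hr; positivity) tendsto_radial]
    norm_num
  have hb : (volume : Measure R4).real (Metric.ball 0 1) = Real.pi ^ 2 / 2 := by
    rw [measureReal_def, EuclideanSpace.volume_ball]
    rw [show ((Fintype.card (Fin 4) : ℝ) / 2 + 1) = ((2 : ℕ) : ℝ) + 1 by norm_num, Real.Gamma_nat_eq_factorial]
    simp only [ENNReal.ofReal_one, one_pow, one_mul, Fintype.card_fin]
    rw [ENNReal.toReal_ofReal (by positivity)]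
    norm_num [Nat.factorial]
    rw [show (4 : ℕ) = 2 * 2 by norm_num, pow_mul, Real.sq_sqrt hpi.le]
  rw [hb] at h
  simp only [regDelta, mul_one]
  rw [h]
  have : ∀ r : ℝ, r ^ (Module.finrank ℝ R4 - 1) • (2 / (Real.pi ^ 2 * (r ^ 2 + 1) ^ 3))
      = 2 / Real.pi ^ 2 * (r ^ 3 / (r ^ 2 + 1) ^ 3) := fun r => by
    simp
    field_simp
  simp only [this]
  rw [integral_const_mul, hint]
  simp
  field_simp

/-- The regularized average of `χ`, after rescaling. -/
lemma integral_regDelta_smul {s : ℝ} (hs : 0 < s) (χ : R4 → ℝ) (x : R4) :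
    ∫ y, regDelta (s ^ 2) (x - y) * χ y = ∫ z, regDelta 1 z * χ (x - s • z) := by
  have h1 := integral_sub_left_eq_self (fun z => regDelta (s ^ 2) z * χ (x - z)) volume x
  simp only [sub_sub_cancel] at h1
  rw [h1]
  have h2 := Measure.integral_comp_smul (volume : Measure R4)
    (fun z => regDelta (s ^ 2) z * χ (x - z)) s
  simp only [regDelta_scale hs, finrank_euclideanSpace, Fintype.card_fin, smul_eq_mul, mul_assoc,
    integral_const_mul] at h2
  rw [abs_of_pos (by positivity)] at h2
  exact (mul_left_cancel₀ (by positivity) h2).symm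

lemma norm_integral_regDelta_le {s M : ℝ} (hs : 0 < s) {χ : R4 → ℝ} (hM : ∀ x, ‖χ x‖ ≤ M) (x : R4) :
    ‖∫ y, regDelta (s ^ 2) (x - y) * χ y‖ ≤ M := by
  rw [integral_regDelta_smul hs]
  have : ∫ z, regDelta 1 z * M = M := by rw [integral_mul_const, integral_regDelta_one, one_mul]
  rw [← this]
  refine norm_integral_le_of_norm_le (integrable_regDelta_one.mul_const M)
    (Eventually.of_forall fun z => ?_)
  rw [norm_mul, Real.norm_of_nonneg (regDelta_nonneg zero_le_one z)]
  exact mul_le_mul_of_nonneg_left (hM _) (regDelta_nonneg zero_le_one z)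

lemma tendsto_integral_regDelta {s : ℕ → ℝ} (hs : ∀ n, 0 < s n) (hs0 : Tendsto s atTop (nhds 0))
    {χ : R4 → ℝ} (hχ : Continuous χ) {M : ℝ} (hM : ∀ x, ‖χ x‖ ≤ M) (x : R4) :
    Tendsto (fun n => ∫ y, regDelta (s n ^ 2) (x - y) * χ y) atTop (nhds (χ x)) := by
  simp only [fun n => integral_regDelta_smul (hs n)]
  have h1 : ∫ z, regDelta 1 z * χ x = χ x := by
    rw [integral_mul_const, integral_regDelta_one, one_mul]
  rw [← h1]
  refine tendsto_integral_of_dominated_convergence (fun z => regDelta 1 z * M) (fun n => ?_)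
    (integrable_regDelta_one.mul_const M) (fun n => Eventually.of_forall fun z => ?_)
    (Eventually.of_forall fun z => ?_)
  · exact ((continuous_regDelta one_pos).mul (hχ.comp (by fun_prop))).aestronglyMeasurable
  · rw [norm_mul, Real.norm_of_nonneg (regDelta_nonneg zero_le_one z)]
    exact mul_le_mul_of_nonneg_left (hM _) (regDelta_nonneg zero_le_one z)
  · refine Tendsto.const_mul _ ((hχ.tendsto x).comp ?_)
    have : Tendsto (fun n => x - s n • z) atTop (nhds (x - (0 : ℝ) • z)) :=
      tendsto_const_nhds.sub (hs0.smul_const z)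
    simpa using this

/-- Fubini moves the averaging from `Ψ`, which is only integrable, onto the continuous `χ`, where it
converges pointwise and boundedly. -/
lemma tendsto_integral_smul_regDelta {s : ℕ → ℝ} (hs : ∀ n, 0 < s n)
    (hs0 : Tendsto s atTop (nhds 0)) {χ : R4 → ℝ} (hχ : Continuous χ) (hc : HasCompactSupport χ)
    {Ψ : R4 → C4} (hΨ : Integrable Ψ volume) :
    Tendsto (fun n => ∫ y, χ y • ∫ x, regDelta (s n ^ 2) (x - y) • Ψ x) atTop
      (nhds (∫ x, χ x • Ψ x)) := by
  obtain ⟨M, hM⟩ := hc.exists_bound_of_continuous hχ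
  have hswap : ∀ n, ∫ y, χ y • ∫ x, regDelta (s n ^ 2) (x - y) • Ψ x
      = ∫ x, (∫ y, regDelta (s n ^ 2) (x - y) * χ y) • Ψ x := by
    intro n
    have hsn : 0 < s n ^ 2 := pow_pos (hs n) 2
    simp only [← integral_smul, ← integral_smul_const]
    rw [integral_integral_swap]
    · refine integral_congr_ae (Eventually.of_forall fun x => integral_congr_ae
        (Eventually.of_forall fun y => ?_))
      simp only [smul_smul, mul_comm]
    · have hp : Integrable (fun p : R4 × R4 => χ p.1 • Ψ p.2) (volume.prod volume) :=
        Integrable.smul_prod (hχ.integrable_of_hasCompactSupport hc) hΨ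
      have hcont : Continuous fun p : R4 × R4 => regDelta (s n ^ 2) (p.2 - p.1) :=
        (continuous_regDelta hsn).comp (by fun_prop)
      refine (hp.bdd_smul (𝕜 := ℝ) (2 * s n ^ 2 / (Real.pi ^ 2 * (s n ^ 2) ^ 3))
        hcont.aestronglyMeasurable (Eventually.of_forall fun p => ?_)).congr
        (Eventually.of_forall fun p => ?_)
      · rw [Real.norm_of_nonneg (regDelta_nonneg hsn.le _)]
        exact regDelta_le hsn _
      · simp only [Function.uncurry, Pi.smul_apply', smul_smul, mul_comm]
  simp only [hswap]
  refine tendsto_integral_of_dominated_convergence (fun x => M * ‖Ψ x‖) (fun n => ?_)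
    (hΨ.norm.const_mul M) (fun n => Eventually.of_forall fun x => ?_)
    (Eventually.of_forall fun x => ?_)
  · have hsn : 0 < s n ^ 2 := pow_pos (hs n) 2
    refine AEStronglyMeasurable.fun_smul ?_ hΨ.1
    have : Continuous fun p : R4 × R4 => regDelta (s n ^ 2) (p.1 - p.2) * χ p.2 :=
      ((continuous_regDelta hsn).comp (by fun_prop)).mul (hχ.comp (by fun_prop))
    exact this.stronglyMeasurable.integral_prod_right.aestronglyMeasurable
  · rw [norm_smul]
    exact mul_le_mul_of_nonneg_right (norm_integral_regDelta_le (hs n) hM x) (norm_nonneg _)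
  · exact (tendsto_integral_regDelta hs hs0 hχ hM x).smul_const _

/-! ### Adjoint and size of the regularized kernel -/

lemma inner_act (A : Mat4) (w z : C4) : inner ℂ (act A w) z = inner ℂ w (act A.conjTranspose z) := by
  have h : act A.conjTranspose = ContinuousLinearMap.adjoint (act A) := by
    rw [act, ← Matrix.star_eq_conjTranspose, map_star, ContinuousLinearMap.star_eq_adjoint, act]
  rw [h, ContinuousLinearMap.adjoint_inner_right]

lemma conjTranspose_alpha (k : Fin 4) : (alpha k).conjTranspose = alpha k := by
  fin_cases k <;> ext i j <;> fin_cases i <;> fin_cases j <;> simp [alpha]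

lemma conjTranspose_Iuc : Iuc.conjTranspose = Iuc := by
  ext i j
  fin_cases i <;> fin_cases j <;> simp [Iuc, beta, mul_add]

/-- The matrices `αₖ` and `I_uc` are Hermitian. The factor `i` changes sign under conjugation, and
the `α`-term is odd in `z`. -/
lemma conjTranspose_regKernel (m ε : ℝ) (z : R4) :
    (regKernel m ε z).conjTranspose = regKernel m ε (-z) := by
  simp only [regKernel, Matrix.conjTranspose_add, Matrix.conjTranspose_smul,
    Matrix.conjTranspose_sum, conjTranspose_alpha, conjTranspose_Iuc, norm_neg]
  simp [neg_div]

lemma norm_act_alpha_le (k : Fin 4) (w : C4) : ‖act (alpha k) w‖ ≤ 16 * ‖w‖ := by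
  simpa using norm_act_le_of_bound (norm_alpha_le k) w

lemma norm_act_Iuc_le (w : C4) : ‖act Iuc w‖ ≤ 16 * ‖w‖ := by
  simpa using norm_act_le_of_bound norm_Iuc_le w

/-- Keeping `|z|² + ε` intact lets one estimate serve both as a bound uniform in `ε ≥ 0` away from
the origin and as a global bound for fixed `ε > 0`. -/
lemma norm_act_regKernel_le_radial (m : ℝ) {ε : ℝ} (hε : 0 ≤ ε) (z : R4) (w : C4) :
    ‖act (regKernel m ε z) w‖ ≤
      (64 * (‖z‖ * (‖z‖ ^ 2 + ε)⁻¹ ^ 2) + 16 * |m| * (‖z‖ ^ 2 + ε)⁻¹) * ‖w‖ := by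
  have hpi : (2 * Real.pi ^ 2)⁻¹ ≤ 1 := inv_le_one_of_one_le₀ (by nlinarith [Real.pi_gt_three])
  have hp : 0 ≤ (‖z‖ ^ 2 + ε)⁻¹ := by positivity
  rw [regKernel_act, add_mul]
  refine (norm_add_le _ _).trans (add_le_add ((norm_sum_le _ _).trans ?_) ?_)
  · have : ∀ l : Fin 4, ‖((2 * Real.pi ^ 2 * (‖z‖ ^ 2 + ε) ^ 2)⁻¹ * z l) •
        (Complex.I • act (alpha l) w)‖ ≤ 16 * (‖z‖ * (‖z‖ ^ 2 + ε)⁻¹ ^ 2) * ‖w‖ := fun l => by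
      rw [norm_smul, norm_smul, Complex.norm_I, one_mul, norm_mul, mul_inv, ← inv_pow, norm_mul,
        Real.norm_of_nonneg (by positivity : 0 ≤ (2 * Real.pi ^ 2)⁻¹),
        Real.norm_of_nonneg (by positivity : 0 ≤ (‖z‖ ^ 2 + ε)⁻¹ ^ 2)]
      calc _ ≤ 1 * (‖z‖ ^ 2 + ε)⁻¹ ^ 2 * ‖z‖ * (16 * ‖w‖) := by
            gcongr
            · exact PiLp.norm_apply_le z l
            · exact norm_act_alpha_le l w
        _ = _ := by ring
    refine (Finset.sum_le_sum fun l _ => this l).trans_eq ?_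
    simp
    ring
  · rw [norm_smul, norm_mul, mul_inv, norm_mul,
      Real.norm_of_nonneg (by positivity : 0 ≤ (2 * Real.pi ^ 2)⁻¹), Real.norm_of_nonneg hp,
      Real.norm_eq_abs]
    calc _ ≤ |m| * (1 * (‖z‖ ^ 2 + ε)⁻¹) * (16 * ‖w‖) := by
          gcongr
          exact norm_act_Iuc_le w
      _ = _ := by ring

lemma norm_act_regKernel_le (m : ℝ) {ε : ℝ} (hε : 0 ≤ ε) {z : R4} (hz : z ≠ 0) (w : C4) :
    ‖act (regKernel m ε z) w‖ ≤ (64 + 16 * |m|) * (‖z‖⁻¹ ^ 2 + ‖z‖⁻¹ ^ 3) * ‖w‖ := by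
  refine (norm_act_regKernel_le_radial m hε z w).trans
    (mul_le_mul_of_nonneg_right ?_ (norm_nonneg _))
  have h0 : 0 < ‖z‖ := norm_pos_iff.2 hz
  have h1 : (‖z‖ ^ 2 + ε)⁻¹ ≤ ‖z‖⁻¹ ^ 2 := by
    rw [inv_pow]; exact inv_anti₀ (by positivity) (by linarith)
  have h2 : ‖z‖ * (‖z‖ ^ 2 + ε)⁻¹ ^ 2 ≤ ‖z‖⁻¹ ^ 3 := by
    calc _ ≤ ‖z‖ * (‖z‖⁻¹ ^ 2) ^ 2 := by gcongr
      _ = _ := by field_simp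
  have h3 : 0 ≤ ‖z‖⁻¹ ^ 2 := by positivity
  have h4 : 0 ≤ ‖z‖⁻¹ ^ 3 := by positivity
  nlinarith [abs_nonneg m, mul_nonneg (abs_nonneg m) h4,
    mul_le_mul_of_nonneg_left h1 (abs_nonneg m)]

lemma exists_norm_act_regKernel_le (m : ℝ) {ε : ℝ} (hε : 0 < ε) :
    ∃ C, ∀ z w, ‖act (regKernel m ε z) w‖ ≤ C * ‖w‖ := by
  refine ⟨64 * ((1 + ε⁻¹) * ε⁻¹) + 16 * |m| * ε⁻¹, fun z w => ?_⟩
  refine (norm_act_regKernel_le_radial m hε.le z w).trans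
    (mul_le_mul_of_nonneg_right ?_ (norm_nonneg _))
  have hD := normSq_pos hε z
  have h1 : (‖z‖ ^ 2 + ε)⁻¹ ≤ ε⁻¹ := inv_anti₀ hε (by nlinarith [sq_nonneg ‖z‖])
  have h2 : ‖z‖ ≤ (1 + ε⁻¹) * (‖z‖ ^ 2 + ε) := by
    have : (1 + ε⁻¹) * (‖z‖ ^ 2 + ε) = ‖z‖ ^ 2 + 1 + ε + ε⁻¹ * ‖z‖ ^ 2 := by
      field_simp; ring
    rw [this]
    have : 0 ≤ ε⁻¹ * ‖z‖ ^ 2 := by positivity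
    nlinarith [sq_nonneg (‖z‖ - 1)]
  have h3 : ‖z‖ * (‖z‖ ^ 2 + ε)⁻¹ ^ 2 ≤ (1 + ε⁻¹) * ε⁻¹ := by
    calc ‖z‖ * (‖z‖ ^ 2 + ε)⁻¹ ^ 2 ≤ ((1 + ε⁻¹) * (‖z‖ ^ 2 + ε)) * (‖z‖ ^ 2 + ε)⁻¹ ^ 2 := by gcongr
      _ = (1 + ε⁻¹) * (‖z‖ ^ 2 + ε)⁻¹ := by field_simp
      _ ≤ _ := by gcongr
  gcongr

lemma measurable_regKernel (m ε : ℝ) (i j : Fin 4) : Measurable fun z => regKernel m ε z i j := by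
  simp only [regKernel, Matrix.add_apply, Matrix.smul_apply, Matrix.sum_apply, smul_eq_mul]
  fun_prop

/-! ### Localization of distributional solutions -/

/-- The right-hand side `θ V ψ + i ∑ₖ (∂ₖ θ) αₖ ψ` of the equation for `θ ψ`. -/
def cutSource (V : R4 → Mat4) (θ : R4 → ℝ) (ψ : R4 → C4) (x : R4) : C4 :=
  θ x • act (V x) (ψ x) +
    Complex.I • ∑ k, fderiv ℝ θ x (EuclideanSpace.single k 1) • act (alpha k) (ψ x)

lemma freeDirac_smul (m : ℝ) {θ : R4 → ℝ} {η : R4 → C4} {x : R4} (hθ : DifferentiableAt ℝ θ x)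
    (hη : DifferentiableAt ℝ η x) :
    freeDirac m (fun x => θ x • η x) x = θ x • freeDirac m η x +
      (-Complex.I) • ∑ k, fderiv ℝ θ x (EuclideanSpace.single k 1) • act (alpha k) (η x) := by
  simp only [freeDirac, fderiv_fun_smul hθ hη, add_apply, smul_apply,
    ContinuousLinearMap.smulRight_apply, map_add, Finset.sum_add_distrib, smul_add]
  simp only [← Complex.coe_smul, map_smul, Finset.smul_sum]
  simp only [smul_smul, mul_comm, mul_neg, neg_mul]
  abel

lemma inner_real_smul_left (r : ℝ) (w z : C4) : inner ℂ (r • w) z = (r : ℂ) * inner ℂ w z := by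
  rw [← Complex.coe_smul, inner_smul_left, Complex.conj_ofReal]

lemma inner_real_smul_right (r : ℝ) (w z : C4) : inner ℂ w (r • z) = (r : ℂ) * inner ℂ w z := by
  rw [← Complex.coe_smul, inner_smul_right]

/-- Test with `θη`. The Leibniz term moves onto `ψ` because the `αₖ` are Hermitian. Since only `θ`
needs compact support, `η` may be a column of the regularized kernel. -/
lemma IsDistributionalSolution.pairing_localized {m : ℝ} {V : R4 → Mat4} {ψ : R4 → C4}
    (h : IsDistributionalSolution m V ψ) {θ : R4 → ℝ} (hθ : ContDiff ℝ ∞ θ)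
    (hc : HasCompactSupport θ) {η : R4 → C4} (hη : ContDiff ℝ ∞ η) :
    ∫ x, (inner ℂ (freeDirac m η x - (m : ℂ) • η x) (θ x • ψ x) +
      inner ℂ (η x) (cutSource V θ ψ x)) = 0 := by
  rw [← h.2 (fun x => θ x • η x) (hθ.smul hη) hc.smul_right]
  refine integral_congr_ae (Eventually.of_forall fun x => ?_)
  simp only [cutSource]
  rw [freeDirac_smul m (hθ.differentiable (by simp) x) (hη.differentiable (by simp) x)]
  simp only [inner_sub_left, inner_add_left, inner_add_right, inner_smul_left, inner_smul_right,
    inner_real_smul_left, inner_real_smul_right, sum_inner, inner_sum, inner_act,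
    conjTranspose_alpha, Complex.conj_ofReal, map_neg, Complex.conj_I, neg_neg]
  ring

lemma aestronglyMeasurable_regKernel (m ε : ℝ) {Φ : R4 → C4} (hΦ : AEStronglyMeasurable Φ volume) :
    AEStronglyMeasurable (fun p : R4 × R4 => act (regKernel m ε (p.1 - p.2)) (Φ p.2))
      (volume.prod volume) :=
  aestronglyMeasurable_act (fun i j => (measurable_regKernel m ε i j).comp (by fun_prop))
    (hΦ.comp_quasiMeasurePreserving Measure.quasiMeasurePreserving_snd)

lemma aestronglyMeasurable_regKernel_left (m ε : ℝ) {Φ : R4 → C4}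
    (hΦ : AEStronglyMeasurable Φ volume) (y : R4) :
    AEStronglyMeasurable (fun x => act (regKernel m ε (y - x)) (Φ x)) volume :=
  aestronglyMeasurable_act (fun i j => (measurable_regKernel m ε i j).comp (by fun_prop)) hΦ

/-- The test function is `G_ε(· - y)c` with a constant spinor `c`. The operator turns it into the
approximate identity, and taking the adjoint of the kernel reverses its argument to `y - x`. -/
lemma IsDistributionalSolution.regularized {m : ℝ} {V : R4 → Mat4} {ψ : R4 → C4}
    (h : IsDistributionalSolution m V ψ) {θ : R4 → ℝ} (hθ : ContDiff ℝ ∞ θ)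
    (hc : HasCompactSupport θ) (hΨ : Integrable (fun x => θ x • ψ x) volume)
    (hΦ : Integrable (cutSource V θ ψ) volume) {ε : ℝ} (hε : 0 < ε) (y : R4) :
    ∫ x, regDelta ε (x - y) • (θ x • ψ x) =
      -∫ x, act (regKernel m ε (y - x)) (cutSource V θ ψ x) := by
  have h1 : Integrable (fun x => regDelta ε (x - y) • (θ x • ψ x)) volume :=
    hΨ.bdd_smul (𝕜 := ℝ) (2 * ε / (Real.pi ^ 2 * ε ^ 3))
      ((continuous_regDelta hε).comp (by fun_prop)).aestronglyMeasurable
      (Eventually.of_forall fun x => by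
        rw [Real.norm_of_nonneg (regDelta_nonneg hε.le _)]; exact regDelta_le hε _)
  have h2 : Integrable (fun x => act (regKernel m ε (y - x)) (cutSource V θ ψ x)) volume := by
    obtain ⟨C, hC⟩ := exists_norm_act_regKernel_le m hε
    exact (hΦ.norm.const_mul C).mono' (aestronglyMeasurable_regKernel_left m ε hΦ.1 y)
      (Eventually.of_forall fun x => hC _ _)
  have h3 : Integrable (fun x => regDelta ε (x - y) • (θ x • ψ x) +
      act (regKernel m ε (y - x)) (cutSource V θ ψ x)) volume := h1.add h2
  rw [eq_neg_iff_add_eq_zero, ← integral_add h1 h2, ← inner_self_eq_zero (𝕜 := ℂ),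
    ← integral_inner h3]
  -- The spinor `c` is the very sum that must vanish, so the tested equation reads `⟨c, c⟩ = 0`.
  generalize (∫ x, regDelta ε (x - y) • (θ x • ψ x) +
      act (regKernel m ε (y - x)) (cutSource V θ ψ x)) = c
  refine Eq.trans ?_ (h.pairing_localized hθ hc (contDiff_regKernel_act m hε y c))
  refine integral_congr_ae (Eventually.of_forall fun x => ?_)
  simp only [freeDirac_regKernel m hε, inner_add_right, inner_real_smul_left,
    inner_real_smul_right, inner_act (regKernel m ε (x - y)), conjTranspose_regKernel, neg_sub]
  ring

/-! ### The limit of the regularized identity -/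

/-- The real-valued version of `nearKernel`. -/
def nearReal (z : R4) : ℝ := (nearKernel z).toReal

lemma nearKernel_ne_top (z : R4) : nearKernel z ≠ ⊤ := by
  unfold nearKernel Set.indicator
  split_ifs <;> simp

lemma integrable_nearReal : Integrable nearReal volume :=
  integrable_toReal_of_lintegral_ne_top measurable_nearKernel.aemeasurable
    lintegral_nearKernel_lt_top.ne

lemma nearReal_nonneg (z : R4) : 0 ≤ nearReal z := ENNReal.toReal_nonneg

lemma one_add_le_nearReal (z : R4) : 1 + ‖z‖ ^ (-3 : ℝ) ≤ 2 + nearReal z := by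
  have h := one_add_le_nearKernel z
  have h2 : (2 : ℝ≥0∞) + nearKernel z = ENNReal.ofReal (2 + nearReal z) := by
    rw [ENNReal.ofReal_add (by norm_num) (nearReal_nonneg z), nearReal,
      ENNReal.ofReal_toReal (nearKernel_ne_top z)]
    norm_num
  rw [h2] at h
  exact (ENNReal.ofReal_le_ofReal_iff (by have := nearReal_nonneg z; positivity)).1 h

/-- This bound does not depend on `ε` and has the form constant plus `L¹` function. Against an
integrable source it gives a convolution that is finite a.e., which dominates the limit `ε → 0`. -/
lemma norm_act_regKernel_le_near (m : ℝ) {ε : ℝ} (hε : 0 ≤ ε) {z : R4} (hz : z ≠ 0) (w : C4) :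
    ‖act (regKernel m ε z) w‖ ≤ (2 * (64 + 16 * |m|)) * (‖w‖ * (2 + nearReal z)) := by
  have h0 : 0 < ‖z‖ := norm_pos_iff.2 hz
  have h3 : ‖z‖ ^ (-3 : ℝ) = ‖z‖⁻¹ ^ 3 := by
    rw [Real.rpow_neg h0.le, inv_pow, ← Real.rpow_natCast]
    norm_num
  have h2 : ‖z‖⁻¹ ^ 2 ≤ 1 + ‖z‖⁻¹ ^ 3 := by
    have : 0 ≤ ‖z‖⁻¹ := by positivity
    generalize ‖z‖⁻¹ = t at this ⊢
    nlinarith [mul_nonneg this (sq_nonneg (t - 1)), sq_nonneg (t - 1)]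
  have h4 := one_add_le_nearReal z
  rw [h3] at h4
  have h5 : ‖z‖⁻¹ ^ 2 + ‖z‖⁻¹ ^ 3 ≤ 2 * (2 + nearReal z) := by
    have : 0 ≤ ‖z‖⁻¹ ^ 3 := by positivity
    linarith
  calc _ ≤ (64 + 16 * |m|) * (‖z‖⁻¹ ^ 2 + ‖z‖⁻¹ ^ 3) * ‖w‖ := norm_act_regKernel_le m hε hz w
    _ ≤ (64 + 16 * |m|) * (2 * (2 + nearReal z)) * ‖w‖ := by gcongr
    _ = _ := by ring

lemma tendsto_act_regKernel (m : ℝ) {ε : ℕ → ℝ} (hε : Tendsto ε atTop (nhds 0)) {z : R4}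
    (hz : z ≠ 0) (w : C4) :
    Tendsto (fun n => act (regKernel m (ε n) z) w) atTop (nhds (act (regKernel m 0 z) w)) := by
  have h0 : 0 < ‖z‖ := norm_pos_iff.2 hz
  have hpi := Real.pi_pos
  have c1 : ContinuousAt (fun e : ℝ => (2 * Real.pi ^ 2 * (‖z‖ ^ 2 + e) ^ 2)⁻¹) 0 :=
    ContinuousAt.inv₀ (by fun_prop) (by positivity)
  have c2 : ContinuousAt (fun e : ℝ => (2 * Real.pi ^ 2 * (‖z‖ ^ 2 + e))⁻¹) 0 :=
    ContinuousAt.inv₀ (by fun_prop) (by positivity)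
  have h : ContinuousAt (fun e : ℝ => act (regKernel m e z) w) 0 := by
    simp only [regKernel_act]
    exact ContinuousAt.add (tendsto_finsetSum _ fun l _ =>
      ContinuousAt.smul (c1.mul continuousAt_const) continuousAt_const)
      (ContinuousAt.smul (continuousAt_const.mul c2) continuousAt_const)
  exact h.tendsto.comp hε

/-- The a.e. finite function dominating the integrals `∫ G_ε(y - x) Φ(x) dx`. -/
def dominator (Φ : R4 → C4) (y : R4) : ℝ := ∫ x, ‖Φ x‖ * (2 + nearReal (y - x))

lemma ae_integrable_dominator {Φ : R4 → C4} (hΦ : Integrable Φ volume) :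
    ∀ᵐ y, Integrable (fun x => ‖Φ x‖ * (2 + nearReal (y - x))) volume := by
  filter_upwards [hΦ.norm.ae_convolution_exists (ContinuousLinearMap.mul ℝ ℝ) integrable_nearReal]
    with y hy
  have : Integrable (fun x => ‖Φ x‖ * nearReal (y - x)) volume := hy
  simp only [mul_add]
  exact (hΦ.norm.mul_const 2).add this

lemma locallyIntegrable_dominator {Φ : R4 → C4} (hΦ : Integrable Φ volume) :
    LocallyIntegrable (dominator Φ) volume := by
  have h1 := hΦ.norm.integrable_convolution (ContinuousLinearMap.mul ℝ ℝ) integrable_nearReal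
  refine ((locallyIntegrable_const (∫ x, ‖Φ x‖ * 2)).add h1.locallyIntegrable).congr ?_
  filter_upwards [hΦ.norm.ae_convolution_exists (ContinuousLinearMap.mul ℝ ℝ) integrable_nearReal]
    with y hy
  have : Integrable (fun x => ‖Φ x‖ * nearReal (y - x)) volume := hy
  simp only [dominator, mul_add]
  rw [integral_add (hΦ.norm.mul_const 2) this]
  rfl

lemma norm_integral_regKernel_le (m : ℝ) {ε : ℝ} (hε : 0 ≤ ε) {Φ : R4 → C4} {y : R4}
    (hy : Integrable (fun x => ‖Φ x‖ * (2 + nearReal (y - x))) volume) :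
    ‖∫ x, act (regKernel m ε (y - x)) (Φ x)‖ ≤ 2 * (64 + 16 * |m|) * dominator Φ y := by
  rw [dominator, ← integral_const_mul]
  refine norm_integral_le_of_norm_le (hy.const_mul _) ?_
  filter_upwards [Measure.ae_ne volume y] with x hx
  exact norm_act_regKernel_le_near m hε (sub_ne_zero.2 hx.symm) _

lemma tendsto_integral_regKernel (m : ℝ) {ε : ℕ → ℝ} (hε : ∀ n, 0 ≤ ε n)
    (hε0 : Tendsto ε atTop (nhds 0)) {Φ : R4 → C4} (hΦ : AEStronglyMeasurable Φ volume) {y : R4}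
    (hy : Integrable (fun x => ‖Φ x‖ * (2 + nearReal (y - x))) volume) :
    Tendsto (fun n => ∫ x, act (regKernel m (ε n) (y - x)) (Φ x)) atTop
      (nhds (∫ x, act (regKernel m 0 (y - x)) (Φ x))) := by
  refine tendsto_integral_of_dominated_convergence _
    (fun n => aestronglyMeasurable_regKernel_left m _ hΦ y)
    (hy.const_mul (2 * (64 + 16 * |m|))) (fun n => ?_) ?_
  · filter_upwards [Measure.ae_ne volume y] with x hx
    exact norm_act_regKernel_le_near m (hε n) (sub_ne_zero.2 hx.symm) _
  · filter_upwards [Measure.ae_ne volume y] with x hx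
    exact tendsto_act_regKernel m hε0 (sub_ne_zero.2 hx.symm) _

/-- Pair with a smooth compactly supported `χ`. The left side tends to `∫ χΨ` by the approximate
identity, the right side to `-∫ χ 𝒢₀Φ` by dominated convergence in both integrals. Equality against
all `χ` is equality a.e. -/
lemma ae_eq_of_regularized (m : ℝ) {Ψ Φ : R4 → C4} (hΨ : Integrable Ψ volume)
    (hΦ : Integrable Φ volume)
    (h : ∀ ε : ℝ, 0 < ε → ∀ y, ∫ x, regDelta ε (x - y) • Ψ x =
      -∫ x, act (regKernel m ε (y - x)) (Φ x)) :
    ∀ᵐ y, Ψ y = -∫ x, act (kernelG0 m y x) (Φ x) := by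
  have hmeas : ∀ ε, AEStronglyMeasurable (fun y => ∫ x, act (regKernel m ε (y - x)) (Φ x)) volume :=
    fun ε => (aestronglyMeasurable_regKernel m ε hΦ.1).integral_prod_right'
  have hdom : ∀ ε, 0 ≤ ε → ∀ᵐ y, ‖∫ x, act (regKernel m ε (y - x)) (Φ x)‖ ≤
      2 * (64 + 16 * |m|) * dominator Φ y := fun ε hε => by
    filter_upwards [ae_integrable_dominator hΦ] with y hy
    exact norm_integral_regKernel_le m hε hy
  have hloc : LocallyIntegrable (fun y => ∫ x, act (regKernel m 0 (y - x)) (Φ x)) volume :=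
    ((locallyIntegrable_dominator hΦ).smul (2 * (64 + 16 * |m|))).mono (hmeas 0) (by
      filter_upwards [hdom 0 le_rfl] with y hy
      refine hy.trans (le_abs_self _))
  have key := ae_eq_zero_of_integral_contDiff_smul_eq_zero (μ := (volume : Measure R4))
    (hΨ.locallyIntegrable.add hloc) fun χ hχ hc => ?_
  · filter_upwards [key] with y hy
    simp only [← regKernel_zero]
    exact eq_neg_of_add_eq_zero_left hy
  have hint : ∀ {f : R4 → C4}, LocallyIntegrable f volume → Integrable (fun y => χ y • f y) volume :=
    fun hf => hf.integrable_smul_left_of_hasCompactSupport hχ.continuous hc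
  simp only [Pi.add_apply, smul_add]
  rw [integral_add (hint hΨ.locallyIntegrable) (hint hloc)]
  have hs : ∀ n : ℕ, (0 : ℝ) < 1 / ((n : ℝ) + 1) := fun n => by positivity
  have hs0 : Tendsto (fun n : ℕ => 1 / ((n : ℝ) + 1)) atTop (nhds 0) :=
    tendsto_one_div_add_atTop_nhds_zero_nat
  have hs2 : Tendsto (fun n : ℕ => (1 / ((n : ℝ) + 1)) ^ 2) atTop (nhds 0) := by
    simpa using hs0.pow 2
  have t1 := tendsto_integral_smul_regDelta hs hs0 hχ.continuous hc hΨ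
  have t2 : Tendsto (fun n : ℕ => ∫ y, χ y • ∫ x,
      act (regKernel m ((1 / ((n : ℝ) + 1)) ^ 2) (y - x)) (Φ x)) atTop
      (nhds (∫ y, χ y • ∫ x, act (regKernel m 0 (y - x)) (Φ x))) := by
    refine tendsto_integral_of_dominated_convergence
      (fun y => ‖χ y • ((2 * (64 + 16 * |m|)) * dominator Φ y)‖)
      (fun n => hχ.continuous.aestronglyMeasurable.fun_smul (hmeas _))
      (((locallyIntegrable_dominator hΦ).smul
        (2 * (64 + 16 * |m|))).integrable_smul_left_of_hasCompactSupport hχ.continuous hc).norm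
      (fun n => ?_) ?_
    · filter_upwards [hdom _ (pow_pos (hs n) 2).le] with y hy
      rw [norm_smul, norm_smul]
      exact mul_le_mul_of_nonneg_left (hy.trans (le_abs_self _)) (norm_nonneg _)
    · filter_upwards [ae_integrable_dominator hΦ] with y hy
      exact (tendsto_integral_regKernel m (fun n => (pow_pos (hs n) 2).le) hs2 hΦ.1 hy).const_smul _
  simp only [fun n => h _ (pow_pos (hs n) 2), smul_neg, integral_neg] at t1
  have := tendsto_nhds_unique t1 t2.neg
  rw [this, neg_add_cancel]

/-! ### Cutoff functions -/

/-- A smooth bump function, equal to `1` on the unit ball and supported in the ball of radius 2. -/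
def bump : ContDiffBump (0 : R4) := ⟨1, 2, one_pos, one_lt_two⟩

/-- The rescaled cutoff function `bump (x / R)`. -/
def cutoff (R : ℝ) (x : R4) : ℝ := bump (R⁻¹ • x)

lemma contDiff_cutoff (R : ℝ) : ContDiff ℝ ∞ (cutoff R) :=
  bump.contDiff.comp (contDiff_const_smul _)

lemma hasCompactSupport_cutoff {R : ℝ} (hR : 0 < R) : HasCompactSupport (cutoff R) :=
  bump.hasCompactSupport.comp_smul (inv_ne_zero hR.ne')

lemma norm_cutoff_le (R : ℝ) (x : R4) : ‖cutoff R x‖ ≤ 1 := by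
  rw [cutoff, Real.norm_of_nonneg bump.nonneg]
  exact bump.le_one

lemma cutoff_eq_one {R : ℝ} (hR : 0 < R) {x : R4} (hx : ‖x‖ ≤ R) : cutoff R x = 1 := by
  refine bump.one_of_mem_closedBall ?_
  rw [mem_closedBall_zero_iff, norm_smul, norm_inv, Real.norm_of_nonneg hR.le]
  exact (inv_mul_le_one₀ hR).2 hx

lemma fderiv_bump_eq_zero {u : R4} (hu : ¬ (1 ≤ ‖u‖ ∧ ‖u‖ ≤ 2)) : fderiv ℝ bump u = 0 := by
  rw [not_and_or, not_le, not_le] at hu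
  rcases hu with hu | hu
  · have : bump =ᶠ[nhds u] fun _ => (1 : ℝ) :=
      bump.eventuallyEq_one_of_mem_ball (by simpa [bump] using hu)
    rw [this.fderiv_eq]
    simp
  · refine image_eq_zero_of_notMem_tsupport fun h => ?_
    have h2 := tsupport_fderiv_subset ℝ h
    rw [bump.tsupport_eq] at h2
    have : ‖u‖ ≤ 2 := by simpa [bump] using h2
    linarith

/-- By scaling, one constant `L` works for every `R`. -/
lemma exists_norm_fderiv_cutoff_le : ∃ L : ℝ, 0 ≤ L ∧ ∀ R : ℝ, 0 < R → ∀ x : R4,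
    ‖fderiv ℝ (cutoff R) x‖ ≤ L * R⁻¹ ∧
      (¬ (R ≤ ‖x‖ ∧ ‖x‖ ≤ 2 * R) → fderiv ℝ (cutoff R) x = 0) := by
  have hcont : Continuous (fderiv ℝ bump) := (bump.contDiff (n := 1)).continuous_fderiv one_ne_zero
  obtain ⟨L, hL⟩ := (bump.hasCompactSupport.fderiv ℝ).exists_bound_of_continuous hcont
  refine ⟨L, (norm_nonneg _).trans (hL 0), fun R hR x => ?_⟩
  have hd : fderiv ℝ (cutoff R) x = R⁻¹ • fderiv ℝ bump (R⁻¹ • x) := by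
    unfold cutoff
    rw [fderiv_comp_smul]
  have hn : ‖R⁻¹ • x‖ = R⁻¹ * ‖x‖ := by rw [norm_smul, norm_inv, Real.norm_of_nonneg hR.le]
  constructor
  · rw [hd, norm_smul, norm_inv, Real.norm_of_nonneg hR.le, mul_comm]
    exact mul_le_mul_of_nonneg_right (hL _) (by positivity)
  · intro h
    rw [hd, fderiv_bump_eq_zero, smul_zero]
    rw [hn]
    intro h2
    refine h ⟨?_, ?_⟩
    · have := (le_inv_mul_iff₀ hR).1 h2.1
      linarith
    · have := (inv_mul_le_iff₀ hR).1 h2.2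
      linarith

/-! ### The commutator term -/

/-- The commutator term `i ∑ₖ (∂ₖ θ) αₖ ψ` of the localized equation. -/
def commTerm (θ : R4 → ℝ) (ψ : R4 → C4) (x : R4) : C4 :=
  Complex.I • ∑ k, fderiv ℝ θ x (EuclideanSpace.single k 1) • act (alpha k) (ψ x)

lemma norm_commTerm_le (θ : R4 → ℝ) (ψ : R4 → C4) (x : R4) :
    ‖commTerm θ ψ x‖ ≤ 64 * ‖fderiv ℝ θ x‖ * ‖ψ x‖ := by
  rw [commTerm, norm_smul, Complex.norm_I, one_mul]
  refine (norm_sum_le _ _).trans ?_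
  calc _ ≤ ∑ _k : Fin 4, ‖fderiv ℝ θ x‖ * (16 * ‖ψ x‖) := by
        refine Finset.sum_le_sum fun k _ => ?_
        rw [norm_smul]
        gcongr
        · refine (ContinuousLinearMap.le_opNorm _ _).trans_eq ?_
          simp
        · exact norm_act_alpha_le k _
    _ = _ := by simp; ring

lemma integrable_commTerm {θ : R4 → ℝ} (hθ : ContDiff ℝ ∞ θ) (hc : HasCompactSupport θ)
    {ψ : R4 → C4} (hψ : LocallyIntegrable ψ volume) : Integrable (commTerm θ ψ) volume := by
  refine Integrable.smul Complex.I (integrable_finsetSum _ fun k _ => ?_)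
  have h1 : Integrable (fun x => fderiv ℝ θ x (EuclideanSpace.single k 1) • ψ x) volume := by
    refine hψ.integrable_smul_left_of_hasCompactSupport ?_ ?_
    · exact (hθ.continuous_fderiv (by simp)).clm_apply continuous_const
    · exact hc.fderiv_apply ℝ _
  refine ((act (alpha k)).integrable_comp h1).congr (Eventually.of_forall fun x => ?_)
  simp only [← Complex.coe_smul, map_smul]

lemma integrable_act_regKernel (m : ℝ) {ε : ℝ} (hε : 0 ≤ ε) {Φ : R4 → C4}
    (hΦ : AEStronglyMeasurable Φ volume) {y : R4}
    (hy : Integrable (fun x => ‖Φ x‖ * (2 + nearReal (y - x))) volume) :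
    Integrable (fun x => act (regKernel m ε (y - x)) (Φ x)) volume := by
  refine (hy.const_mul (2 * (64 + 16 * |m|))).mono' (aestronglyMeasurable_regKernel_left m _ hΦ y) ?_
  filter_upwards [Measure.ae_ne volume y] with x hx
  exact norm_act_regKernel_le_near m hε (sub_ne_zero.2 hx.symm) _

lemma bracket_le_one_add (x : R4) : bracket x ≤ 1 + ‖x‖ := by
  rw [bracket, Real.sqrt_le_left (by positivity)]
  nlinarith [norm_nonneg x]

lemma norm_le_bracket (x : R4) : ‖x‖ ≤ bracket x := by
  refine Real.le_sqrt_of_sq_le ?_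
  linarith

/-- On the annulus `R ≤ |x| ≤ 2R` the kernel is `O(R⁻²)`, the gradient of the cutoff `O(R⁻¹)`, and
`|ψ| = O(R) f` with `f = ⟨x⟩⁻¹|ψ|`. The integrand is `O(R⁻² f)`. The annulus has volume `O(R⁴)`, so
Cauchy–Schwarz bounds the integral by the `L²` norm of `f` on `|x| ≥ R`, which tends to zero. -/
lemma tendsto_integral_commTerm (m : ℝ) {ψ : R4 → C4}
    (hW : MemLp (fun x => (bracket x)⁻¹ * ‖ψ x‖) 2 volume) (y : R4) :
    Tendsto (fun n : ℕ => ∫ x, act (regKernel m 0 (y - x)) (commTerm (cutoff (n + 1)) ψ x)) atTop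
      (nhds 0) := by
  obtain ⟨L, hL0, hL⟩ := exists_norm_fderiv_cutoff_le
  set f : R4 → ℝ := fun x => (bracket x)⁻¹ * ‖ψ x‖ with hf
  have hf2 : Integrable (fun x => f x ^ 2) volume := hW.integrable_sq
  set κ : ℝ := (volume : Measure R4).real (Metric.ball 0 1) with hκ
  set C : ℝ := (64 + 16 * |m|) * 8 * (64 * L * 3) with hC
  have hC0 : 0 ≤ C := by positivity
  set a : ℕ → ℝ := fun n => ∫ x in {x : R4 | (n : ℝ) + 1 ≤ ‖x‖}, f x ^ 2 with ha
  have hms : ∀ n : ℕ, MeasurableSet {x : R4 | (n : ℝ) + 1 ≤ ‖x‖} := fun n =>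
    measurableSet_le measurable_const measurable_norm
  have ha0 : Tendsto a atTop (nhds 0) := by
    have := tendsto_setIntegral_of_antitone (μ := (volume : Measure R4)) (f := fun x => f x ^ 2)
      (s := fun n : ℕ => {x : R4 | (n : ℝ) + 1 ≤ ‖x‖}) hms
      (fun i j hij x (hx : (j : ℝ) + 1 ≤ ‖x‖) => by
        have : (i : ℝ) ≤ j := by exact_mod_cast hij
        change (i : ℝ) + 1 ≤ ‖x‖
        linarith) ⟨0, hf2.integrableOn⟩
    have he : (⋂ n : ℕ, {x : R4 | (n : ℝ) + 1 ≤ ‖x‖}) = ∅ := by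
      refine Set.eq_empty_of_forall_notMem fun x hx => ?_
      obtain ⟨n, hn⟩ := exists_nat_gt ‖x‖
      have : (n : ℝ) + 1 ≤ ‖x‖ := Set.mem_iInter.1 hx n
      linarith
    rwa [he, setIntegral_empty] at this
  -- Cauchy–Schwarz appears as `R⁻² f ≤ δR⁻⁴ + δ⁻¹f²` with a free `δ`. The ball of radius `2R` has
  -- volume `16κR⁴`, which gives the first term. The condition on `n` ensures `|y - x| ≥ R/2 ≥ 1` on
  -- the annulus.
  have hest : ∀ (n : ℕ) (δ : ℝ), 0 < δ → 2 * ‖y‖ + 2 ≤ (n : ℝ) + 1 →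
      ‖∫ x, act (regKernel m 0 (y - x)) (commTerm (cutoff (n + 1)) ψ x)‖
        ≤ C * (16 * κ * δ) + C * (δ⁻¹ * a n) := by
    intro n δ hδ hn
    set R : ℝ := (n : ℝ) + 1 with hR
    have hR0 : 0 < R := by positivity
    have hR1 : 1 ≤ R := by rw [hR]; linarith [(Nat.cast_nonneg n : (0 : ℝ) ≤ n)]
    have hvol : ∫ x, (Metric.closedBall (0 : R4) (2 * R)).indicator (fun _ => δ * R⁻¹ ^ 4) x
        = 16 * κ * δ := by
      rw [integral_indicator measurableSet_closedBall, setIntegral_const, measureReal_def,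
        Measure.addHaar_closedBall _ _ (by positivity), ENNReal.toReal_mul,
        ENNReal.toReal_ofReal (by positivity), ← measureReal_def]
      simp only [finrank_euclideanSpace, Fintype.card_fin, smul_eq_mul]
      field_simp
      norm_num [hκ]
    have hi1 : Integrable ((Metric.closedBall (0 : R4) (2 * R)).indicator
        (fun _ => δ * R⁻¹ ^ 4)) volume := by
      rw [integrable_indicator_iff measurableSet_closedBall]
      exact integrableOn_const (measure_closedBall_lt_top.ne)
    have hi2 : Integrable ({x : R4 | R ≤ ‖x‖}.indicator (fun x => δ⁻¹ * f x ^ 2)) volume :=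
      (hf2.const_mul _).indicator (hms n)
    have hval : C * (16 * κ * δ) + C * (δ⁻¹ * a n) =
        ∫ x, (C * (Metric.closedBall (0 : R4) (2 * R)).indicator (fun _ => δ * R⁻¹ ^ 4) x +
          C * {x : R4 | R ≤ ‖x‖}.indicator (fun x => δ⁻¹ * f x ^ 2) x) := by
      rw [integral_add (hi1.const_mul _) (hi2.const_mul _), integral_const_mul, integral_const_mul,
        hvol, integral_indicator (hms n), integral_const_mul]
    rw [hval]
    refine norm_integral_le_of_norm_le ((hi1.const_mul _).add (hi2.const_mul _))
      (Eventually.of_forall fun x => ?_)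
    by_cases hx : R ≤ ‖x‖ ∧ ‖x‖ ≤ 2 * R
    · rw [Set.indicator_of_mem (by simpa using hx.2), Set.indicator_of_mem (by exact hx.1)]
      have hyx : R / 2 ≤ ‖y - x‖ := by
        have := norm_sub_norm_le x y
        rw [norm_sub_rev] at this
        linarith
      have hyx1 : 1 ≤ ‖y - x‖ := by linarith [norm_nonneg y]
      have hinv : ‖y - x‖⁻¹ ≤ 2 * R⁻¹ := by
        calc ‖y - x‖⁻¹ ≤ (R / 2)⁻¹ := inv_anti₀ (by positivity) hyx
          _ = _ := by field_simp
      have hinv1 : ‖y - x‖⁻¹ ≤ 1 := inv_le_one_of_one_le₀ hyx1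
      have hker : ‖y - x‖⁻¹ ^ 2 + ‖y - x‖⁻¹ ^ 3 ≤ 8 * R⁻¹ ^ 2 := by
        have h0 : 0 ≤ ‖y - x‖⁻¹ := by positivity
        generalize ‖y - x‖⁻¹ = t at *
        have h1 : t ^ 3 ≤ t ^ 2 := pow_le_pow_of_le_one h0 hinv1 (by norm_num)
        have h2 : t ^ 2 ≤ (2 * R⁻¹) ^ 2 := by gcongr
        linarith
      have hψ : ‖ψ x‖ ≤ 3 * R * f x := by
        have hb := bracket_pos x
        have : ‖ψ x‖ = bracket x * f x := by rw [hf]; field_simp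
        have hf0 : 0 ≤ f x := by rw [hf]; positivity
        rw [this]
        have := bracket_le_one_add x
        gcongr
        linarith
      have hcomm : ‖commTerm (cutoff R) ψ x‖ ≤ 64 * L * 3 * f x := by
        calc _ ≤ 64 * ‖fderiv ℝ (cutoff R) x‖ * ‖ψ x‖ := norm_commTerm_le _ _ _
          _ ≤ 64 * (L * R⁻¹) * (3 * R * f x) := by
            gcongr
            exact (hL R hR0 x).1
          _ = _ := by field_simp
      have hne : y - x ≠ 0 := norm_pos_iff.1 (by linarith)
      calc _ ≤ (64 + 16 * |m|) * (‖y - x‖⁻¹ ^ 2 + ‖y - x‖⁻¹ ^ 3) * ‖commTerm (cutoff R) ψ x‖ :=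
            norm_act_regKernel_le m le_rfl hne _
        _ ≤ (64 + 16 * |m|) * (8 * R⁻¹ ^ 2) * (64 * L * 3 * f x) := by gcongr
        _ = C * (R⁻¹ ^ 2 * f x) := by rw [hC]; ring
        _ ≤ C * (δ * R⁻¹ ^ 4 + δ⁻¹ * f x ^ 2) := by
            gcongr
            have h1 : δ * δ⁻¹ = 1 := mul_inv_cancel₀ hδ.ne'
            have h2 : 0 < δ⁻¹ := inv_pos.2 hδ
            nlinarith [mul_nonneg hδ.le (sq_nonneg (R⁻¹ ^ 2 - δ⁻¹ * f x)),
              mul_nonneg hδ.le (sq_nonneg (R⁻¹ ^ 2)), mul_nonneg h2.le (sq_nonneg (f x))]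
        _ = _ := by ring
    · have : commTerm (cutoff R) ψ x = 0 := by
        simp [commTerm, (hL R hR0 x).2 hx]
      rw [this, map_zero, norm_zero]
      refine add_nonneg (mul_nonneg hC0 (Set.indicator_nonneg (fun _ _ => by positivity) _))
        (mul_nonneg hC0 (Set.indicator_nonneg (fun _ _ => by positivity) _))
  have ha_nonneg : ∀ n, 0 ≤ a n := fun n => setIntegral_nonneg (hms n) fun x _ => sq_nonneg _
  have hκ0 : 0 ≤ κ := measureReal_nonneg
  have hs0 : Tendsto (fun n : ℕ => 1 / ((n : ℝ) + 1)) atTop (nhds 0) :=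
    tendsto_one_div_add_atTop_nhds_zero_nat
  -- The choice `δ = √(a n)` balances the two terms. The summand `1/(n+1)` keeps `δ` positive when
  -- the tail `a n` vanishes.
  have hδ0 : Tendsto (fun n : ℕ => √(a n) + 1 / ((n : ℝ) + 1)) atTop (nhds 0) := by
    simpa using (ha0.sqrt).add hs0
  have hlim : Tendsto (fun n : ℕ => C * (16 * κ * (√(a n) + 1 / ((n : ℝ) + 1))) + C * √(a n))
      atTop (nhds 0) := by
    simpa using ((hδ0.const_mul (16 * κ)).const_mul C).add (ha0.sqrt.const_mul C)
  refine squeeze_zero_norm' ?_ hlim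
  obtain ⟨N, hN⟩ := exists_nat_gt (2 * ‖y‖ + 2)
  filter_upwards [eventually_ge_atTop N] with n hn
  have hnN : (N : ℝ) ≤ n := by exact_mod_cast hn
  have hpos : 0 < √(a n) + 1 / ((n : ℝ) + 1) := by positivity
  refine (hest n _ hpos (by linarith)).trans ?_
  gcongr
  rw [inv_mul_le_iff₀ hpos]
  have h1 : √(a n) * √(a n) = a n := Real.mul_self_sqrt (ha_nonneg n)
  have h2 : 0 ≤ 1 / ((n : ℝ) + 1) * √(a n) := by positivity
  linarith

/-! ### The integral equation `ψ = -𝒢₀ V ψ` -/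

/-- Each cutoff satisfies the equation with source `θVψ` plus the commutator term. As the radius
grows, `θ(y)` is eventually `1`, the first source converges by dominated convergence, and the
commutator contribution vanishes. -/
lemma IsDistributionalSolution.ae_eq {m : ℝ} {V : R4 → Mat4} {ψ : R4 → C4}
    (h : IsDistributionalSolution m V ψ)
    (hg : Integrable (fun x => act (V x) (ψ x)) volume)
    (hW : MemLp (fun x => (bracket x)⁻¹ * ‖ψ x‖) 2 volume) :
    ∀ᵐ y, ψ y = -∫ x, act (kernelG0 m y x) (act (V x) (ψ x)) := by
  set g : R4 → C4 := fun x => act (V x) (ψ x) with hgdef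
  have hR : ∀ n : ℕ, (0 : ℝ) < (n : ℝ) + 1 := fun n => by positivity
  have hcs : ∀ n : ℕ, HasCompactSupport (cutoff ((n : ℝ) + 1)) :=
    fun n => hasCompactSupport_cutoff (hR n)
  have hΨ : ∀ n : ℕ, Integrable (fun x => cutoff ((n : ℝ) + 1) x • ψ x) volume := fun n =>
    h.1.integrable_smul_left_of_hasCompactSupport (contDiff_cutoff _).continuous (hcs n)
  have hE : ∀ n : ℕ, Integrable (commTerm (cutoff ((n : ℝ) + 1)) ψ) volume := fun n =>
    integrable_commTerm (contDiff_cutoff _) (hcs n) h.1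
  have hθg : ∀ n : ℕ, Integrable (fun x => cutoff ((n : ℝ) + 1) x • g x) volume := fun n =>
    hg.bdd_smul (𝕜 := ℝ) 1 (contDiff_cutoff _).continuous.aestronglyMeasurable
      (Eventually.of_forall (norm_cutoff_le _))
  have hΦ : ∀ n : ℕ, Integrable (cutSource V (cutoff ((n : ℝ) + 1)) ψ) volume := fun n =>
    (hθg n).add (hE n)
  -- The radii run through a sequence so that a single null set serves all cutoffs.
  have hrep : ∀ᵐ y, ∀ n : ℕ, cutoff ((n : ℝ) + 1) y • ψ y =
      -∫ x, act (kernelG0 m y x) (cutSource V (cutoff ((n : ℝ) + 1)) ψ x) :=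
    ae_all_iff.2 fun n => ae_eq_of_regularized m (hΨ n) (hΦ n) fun ε hε y =>
      h.regularized (contDiff_cutoff _) (hcs n) (hΨ n) (hΦ n) hε y
  have hEd := ae_all_iff.2 fun n : ℕ => ae_integrable_dominator (hE n)
  filter_upwards [hrep, hEd, ae_integrable_dominator hg] with y hy hyE hyg
  simp only [← regKernel_zero] at hy ⊢
  have hdom : ∀ (n : ℕ), ∀ᵐ x, ‖act (regKernel m 0 (y - x)) (cutoff ((n : ℝ) + 1) x • g x)‖ ≤
      ‖act (regKernel m 0 (y - x)) (g x)‖ := fun n => Eventually.of_forall fun x => by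
    rw [← Complex.coe_smul, map_smul, norm_smul, Complex.norm_real]
    exact mul_le_of_le_one_left (norm_nonneg _) (norm_cutoff_le _ _)
  have hig : Integrable (fun x => act (regKernel m 0 (y - x)) (g x)) volume :=
    integrable_act_regKernel m le_rfl hg.1 hyg
  have hiθ : ∀ n : ℕ, Integrable
      (fun x => act (regKernel m 0 (y - x)) (cutoff ((n : ℝ) + 1) x • g x)) volume := fun n =>
    hig.mono (aestronglyMeasurable_regKernel_left m 0 (hθg n).1 y) (hdom n)
  have hsplit : ∀ n : ℕ, ∫ x, act (regKernel m 0 (y - x)) (cutSource V (cutoff ((n : ℝ) + 1)) ψ x)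
      = (∫ x, act (regKernel m 0 (y - x)) (cutoff ((n : ℝ) + 1) x • g x)) +
        ∫ x, act (regKernel m 0 (y - x)) (commTerm (cutoff ((n : ℝ) + 1)) ψ x) := fun n => by
    rw [← integral_add (hiθ n) (integrable_act_regKernel m le_rfl (hE n).1 (hyE n))]
    simp only [← map_add]
    rfl
  have hone : ∀ x : R4, ∀ᶠ n : ℕ in atTop, cutoff ((n : ℝ) + 1) x = 1 := fun x => by
    obtain ⟨N, hN⟩ := exists_nat_gt ‖x‖
    filter_upwards [eventually_ge_atTop N] with n hn
    have : (N : ℝ) ≤ n := by exact_mod_cast hn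
    exact cutoff_eq_one (hR n) (by linarith)
  have t1 : Tendsto (fun n : ℕ => ∫ x, act (regKernel m 0 (y - x)) (cutoff ((n : ℝ) + 1) x • g x))
      atTop (nhds (∫ x, act (regKernel m 0 (y - x)) (g x))) := by
    refine tendsto_integral_of_dominated_convergence _ (fun n => (hiθ n).1) hig.norm hdom
      (Eventually.of_forall fun x => tendsto_const_nhds.congr' ?_)
    filter_upwards [hone x] with n hn
    rw [hn, one_smul]
  have t2 := (t1.add (tendsto_integral_commTerm m hW y)).neg
  rw [add_zero] at t2
  refine tendsto_nhds_unique (tendsto_const_nhds.congr' ?_) t2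
  filter_upwards [hone y] with n hn
  rw [← hsplit, ← hy n, hn, one_smul]

/-! ### Weighted bounds for `V ψ` -/

lemma memLp_bracket_rpow {s : ℝ} (hs : 0 < s) :
    MemLp (fun x : R4 => bracket x ^ (-(2 + s))) 2 volume := by
  rw [memLp_two_iff_integrable_sq (measurable_bracket.pow_const _).aestronglyMeasurable]
  refine (integrable_rpow_neg_one_add_norm_sq (E := R4) (μ := volume) (r := 4 + 2 * s)
    (by simp; linarith)).congr (Eventually.of_forall fun x => ?_)
  simp only [bracket]
  rw [Real.sqrt_eq_rpow, ← Real.rpow_mul (by positivity), sq (_ ^ (1 / 2 * _)),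
    ← Real.rpow_add (by positivity)]
  congr 1
  ring

/-- The weight `⟨x⟩⁻¹` is the weakest one allowed. It is the common hypothesis under which both
weighted and `L²` solutions are treated. -/
lemma memLp_bracket_inv_of_weighted {s : ℝ} (hs : s ≤ 1) {ψ : R4 → C4} (hψ : MemL2Weighted (-s) ψ)
    (hm : AEStronglyMeasurable ψ volume) : MemLp (fun x => (bracket x)⁻¹ * ‖ψ x‖) 2 volume := by
  refine MemLp.mono hψ (measurable_bracket.inv.aestronglyMeasurable.mul hm.norm)
    (Eventually.of_forall fun x => ?_)
  have hb := bracket_pos x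
  rw [norm_mul, norm_norm, norm_smul, Complex.norm_real, Real.norm_of_nonneg (by positivity),
    Real.norm_of_nonneg (by positivity), ← Real.rpow_neg_one]
  gcongr
  exact one_le_bracket x

lemma memLp_bracket_inv_of_memLp {ψ : R4 → C4} (hψ : MemLp ψ 2 volume) :
    MemLp (fun x => (bracket x)⁻¹ * ‖ψ x‖) 2 volume := by
  refine MemLp.mono hψ (measurable_bracket.inv.aestronglyMeasurable.mul hψ.1.norm)
    (Eventually.of_forall fun x => ?_)
  have hb := bracket_pos x
  rw [norm_mul, norm_norm, Real.norm_of_nonneg (by positivity)]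
  exact mul_le_of_le_one_left (norm_nonneg _) (inv_le_one_of_one_le₀ (one_le_bracket x))

lemma act_mul (A B : Mat4) (w : C4) : act (A * B) w = act A (act B w) := by
  simp [act]

section factorization

variable {V : R4 → Mat4} (F : Diagonalization V)

lemma Diagonalization.act_V (x : R4) (w : C4) :
    act (V x) w = act (F.v x).conjTranspose (act (F.U x) (act (F.v x) w)) := by
  rw [← act_mul, ← act_mul, F.eq x]
  congr 2
  simp only [Diagonalization.v, Diagonalization.U, Matrix.conjTranspose_mul,
    Matrix.diagonal_conjTranspose, ← Matrix.mul_assoc]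
  congr 1
  simp only [Matrix.mul_assoc, Matrix.diagonal_mul_diagonal]
  congr 2
  funext j
  have h : (√|F.lam x j| : ℂ) * √|F.lam x j| = |F.lam x j| := by
    rw [← Complex.ofReal_mul, Real.mul_self_sqrt (abs_nonneg _)]
  simp only [Pi.star_apply, RCLike.star_def, Complex.conj_ofReal]
  rw [mul_right_comm, h, sgn]
  split_ifs with h0
  · rw [abs_of_nonneg h0, mul_one]
  · rw [abs_of_neg (not_le.1 h0)]
    simp

lemma Diagonalization.norm_act_U_le (x : R4) (w : C4) : ‖act (F.U x) w‖ ≤ 16 * ‖w‖ := by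
  simpa using norm_act_le_of_bound (F.norm_U_le x) w

lemma exists_norm_act_v_le (hv : DecaysFasterThan 2 F.v) :
    ∃ C s : ℝ, 0 < s ∧ 0 ≤ C ∧ ∀ x w, ‖act (F.v x) w‖ ≤ C * bracket x ^ (-(2 + s)) * ‖w‖ ∧
      ‖act (F.v x).conjTranspose w‖ ≤ C * bracket x ^ (-(2 + s)) * ‖w‖ := by
  obtain ⟨C, s, hs, hC⟩ := hv
  have hC0 : 0 ≤ C := by
    have h := (norm_nonneg _).trans (hC 0 0 0)
    exact nonneg_of_mul_nonneg_left h (Real.rpow_pos_of_pos (bracket_pos 0) _)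
  refine ⟨16 * C, s, hs, by positivity, fun x w => ⟨?_, ?_⟩⟩
  · rw [mul_assoc 16 C]
    exact norm_act_le_of_bound (hC x) w
  · rw [mul_assoc 16 C]
    refine norm_act_le_of_bound (fun i j => ?_) w
    rw [Matrix.conjTranspose_apply, norm_star]
    exact hC x j i

lemma exists_norm_act_V_le (hv : DecaysFasterThan 2 F.v) :
    ∃ C s : ℝ, 0 < s ∧ 0 ≤ C ∧ ∀ x w, ‖act (V x) w‖ ≤ C * bracket x ^ (-(4 + s)) * ‖w‖ := by
  obtain ⟨C, s, hs, hC0, hC⟩ := exists_norm_act_v_le F hv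
  refine ⟨16 * C ^ 2, s, hs, by positivity, fun x w => ?_⟩
  have hb := bracket_pos x
  set t := bracket x ^ (-(2 + s)) with ht
  have ht0 : 0 < t := Real.rpow_pos_of_pos hb _
  have htt : t * t ≤ bracket x ^ (-(4 + s)) := by
    rw [ht, ← Real.rpow_add hb]
    exact Real.rpow_le_rpow_of_exponent_le (one_le_bracket x) (by linarith)
  rw [F.act_V]
  calc _ ≤ C * t * ‖act (F.U x) (act (F.v x) w)‖ := (hC x _).2
    _ ≤ C * t * (16 * (C * t * ‖w‖)) := by
        gcongr
        refine (F.norm_act_U_le x _).trans ?_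
        gcongr
        exact (hC x w).1
    _ = 16 * C ^ 2 * (t * t) * ‖w‖ := by ring
    _ ≤ _ := by gcongr

lemma aestronglyMeasurable_V (F : Diagonalization V) {ψ : R4 → C4} (hm : AEStronglyMeasurable ψ volume) :
    AEStronglyMeasurable (fun x => act (V x) (ψ x)) volume := by
  simp only [F.act_V]
  refine aestronglyMeasurable_act (fun i j => ?_) (aestronglyMeasurable_act F.measurable_U
    (aestronglyMeasurable_act F.measurable_v hm))
  simp only [Matrix.conjTranspose_apply]
  exact continuous_star.measurable.comp (F.measurable_v j i)

/-- Since `V = O(⟨x⟩^{-4-s})`, the function is at most a multiple of `⟨x⟩^{-2-s} · ⟨x⟩⁻¹|ψ|`, a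
product of two `L²` functions. This first moment pays for the expansion of `𝒢₀ Vψ` at infinity. -/
lemma integrable_bracket_mul_norm_V (hv : DecaysFasterThan 2 F.v) {ψ : R4 → C4}
    (hm : AEStronglyMeasurable ψ volume)
    (hW : MemLp (fun x => (bracket x)⁻¹ * ‖ψ x‖) 2 volume) :
    Integrable (fun x => bracket x * ‖act (V x) (ψ x)‖) volume := by
  obtain ⟨C, s, hs, hC0, hC⟩ := exists_norm_act_V_le F hv
  refine (((memLp_bracket_rpow hs).integrable_mul hW).const_mul C).mono'
    (measurable_bracket.aestronglyMeasurable.mul (aestronglyMeasurable_V F hm).norm)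
    (Eventually.of_forall fun x => ?_)
  have hb := bracket_pos x
  rw [norm_mul, norm_norm, Real.norm_of_nonneg hb.le]
  calc _ ≤ bracket x * (C * bracket x ^ (-(4 + s)) * ‖ψ x‖) := by gcongr; exact hC x _
    _ = C * (bracket x ^ (-(2 + s)) * ((bracket x)⁻¹ * ‖ψ x‖)) := by
      have : bracket x ^ (-(2 + s)) = bracket x ^ (-(4 + s)) * bracket x * bracket x := by
        rw [← Real.rpow_add_one hb.ne', ← Real.rpow_add_one hb.ne']
        congr 1; ring
      rw [this]
      field_simp

lemma integrable_V (hv : DecaysFasterThan 2 F.v) {ψ : R4 → C4}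
    (hm : AEStronglyMeasurable ψ volume)
    (hW : MemLp (fun x => (bracket x)⁻¹ * ‖ψ x‖) 2 volume) :
    Integrable (fun x => act (V x) (ψ x)) volume := by
  refine (integrable_bracket_mul_norm_V F hv hm hW).mono' (aestronglyMeasurable_V F hm)
    (Eventually.of_forall fun x => ?_)
  exact le_mul_of_one_le_left (norm_nonneg _) (one_le_bracket x)

end factorization

/-! ### Asymptotics of `𝒢₀ g` at infinity -/

lemma bracket_sq (x : R4) : bracket x ^ 2 = 1 + ‖x‖ ^ 2 := Real.sq_sqrt (by positivity)

/-- In polar coordinates the squared norm is a multiple of `∫ r³(1+r²)⁻² dr`, which diverges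
logarithmically. For `r > 1` the integrand is at least `1/(4r)`. -/
lemma not_memLp_bracket_sq_inv : ¬ MemLp (fun x : R4 => (bracket x ^ 2)⁻¹) 2 volume := by
  have hm : AEStronglyMeasurable (fun x : R4 => (bracket x ^ 2)⁻¹) volume :=
    (measurable_bracket.pow_const 2).inv.aestronglyMeasurable
  rw [memLp_two_iff_integrable_sq hm]
  simp only [bracket_sq]
  intro h
  have h2 := (integrable_fun_norm_addHaar (volume : Measure R4)
    (f := fun r : ℝ => ((1 + r ^ 2)⁻¹) ^ 2)).1 h
  simp only [finrank_euclideanSpace, Fintype.card_fin, smul_eq_mul] at h2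
  have h3 : IntegrableOn (fun r : ℝ => r ^ (4 - 1) * ((1 + r ^ 2)⁻¹) ^ 2) (Set.Ioi 1) volume :=
    h2.mono_set (Set.Ioi_subset_Ioi zero_le_one)
  refine not_integrableOn_Ioi_inv (a := 1) ((h3.const_mul 4).mono'
    measurable_inv.aestronglyMeasurable ?_)
  filter_upwards [ae_restrict_mem measurableSet_Ioi] with r (hr : 1 < r)
  have hr0 : 0 < r := by linarith
  rw [Real.norm_of_nonneg (by positivity), inv_pow, ← div_eq_mul_inv, ← mul_div_assoc,
    le_div_iff₀ (by positivity), inv_mul_le_iff₀ hr0]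
  have : 1 + r ^ 2 ≤ 2 * r ^ 2 := by nlinarith
  calc (1 + r ^ 2) ^ 2 ≤ (2 * r ^ 2) ^ 2 := by gcongr
    _ = _ := by ring

lemma regKernel_zero_act (m : ℝ) (z : R4) (w : C4) :
    act (regKernel m 0 z) w = act (regKernel 0 0 z) w
      + (m / (2 * Real.pi ^ 2) * (‖z‖ ^ 2)⁻¹) • act Iuc w := by
  simp only [regKernel_act, add_zero, zero_mul, zero_smul, mul_inv, div_eq_mul_inv, mul_assoc]

/-- Replacing `|x-y|⁻²` by `⟨x⟩⁻²` gains one power of decay at the cost of a factor `⟨y⟩`. The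
comparison passes through `⟨x-y⟩⁻²`, where the difference of squares factors and the triangle
inequality applies. -/
lemma abs_inv_sq_sub_le {x y : R4} (hz : 1 ≤ ‖x - y‖) :
    |(‖x - y‖ ^ 2)⁻¹ - (bracket x ^ 2)⁻¹| ≤
      4 * bracket y * ((bracket (x - y))⁻¹ ^ 3 + (bracket x)⁻¹ ^ 3) := by
  set r := ‖x - y‖ with hr
  set a := bracket x with ha
  set b := bracket (x - y) with hb
  have ha0 : 0 < a := bracket_pos x
  have hb0 : 0 < b := bracket_pos (x - y)
  have hy1 : 1 ≤ bracket y := one_le_bracket y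
  have ha2 : a ^ 2 = 1 + ‖x‖ ^ 2 := bracket_sq x
  have hb2 : b ^ 2 = 1 + r ^ 2 := bracket_sq (x - y)
  have hbr : b ≤ 2 * r := by nlinarith
  have hp : 0 < a⁻¹ := by positivity
  have hq : 0 < b⁻¹ := by positivity
  have h1 : |(r ^ 2)⁻¹ - (b ^ 2)⁻¹| ≤ 2 * b⁻¹ ^ 3 := by
    have h : (r ^ 2)⁻¹ - (b ^ 2)⁻¹ = r⁻¹ * r⁻¹ * b⁻¹ ^ 2 := by
      have : r ^ 2 = b ^ 2 - 1 := by linarith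
      field_simp
      linarith
    rw [h, abs_of_nonneg (by positivity)]
    have h2 : r⁻¹ ≤ 2 * b⁻¹ := by
      rw [← div_eq_mul_inv, le_div_iff₀ hb0, inv_mul_le_iff₀ (by linarith)]
      linarith
    calc r⁻¹ * r⁻¹ * b⁻¹ ^ 2 ≤ 1 * (2 * b⁻¹) * b⁻¹ ^ 2 := by
          gcongr
          exact inv_le_one_of_one_le₀ hz
      _ = _ := by ring
  have h3 : |(b ^ 2)⁻¹ - (a ^ 2)⁻¹| ≤ bracket y * (2 * (b⁻¹ ^ 3 + a⁻¹ ^ 3)) := by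
    have h : (b ^ 2)⁻¹ - (a ^ 2)⁻¹ = (a ^ 2 - b ^ 2) * (a⁻¹ ^ 2 * b⁻¹ ^ 2) := by field_simp
    have hd : |a ^ 2 - b ^ 2| ≤ bracket y * (a + b) := by
      have e : a ^ 2 - b ^ 2 = (‖x‖ - r) * (‖x‖ + r) := by rw [ha2, hb2]; ring
      have hxr : 0 ≤ ‖x‖ + r := by positivity
      rw [e, abs_mul, abs_of_nonneg hxr]
      have h4 : |‖x‖ - r| ≤ bracket y := by
        refine (abs_norm_sub_norm_le x (x - y)).trans ?_
        rw [sub_sub_cancel]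
        exact norm_le_bracket y
      have h5 : ‖x‖ + r ≤ a + b := add_le_add (norm_le_bracket x) (norm_le_bracket (x - y))
      gcongr
    rw [h, abs_mul, abs_of_nonneg (by positivity : 0 ≤ a⁻¹ ^ 2 * b⁻¹ ^ 2)]
    calc |a ^ 2 - b ^ 2| * (a⁻¹ ^ 2 * b⁻¹ ^ 2)
        ≤ bracket y * (a + b) * (a⁻¹ ^ 2 * b⁻¹ ^ 2) := by gcongr
      _ = bracket y * (a⁻¹ * b⁻¹ ^ 2 + a⁻¹ ^ 2 * b⁻¹) := by field_simp
      _ ≤ bracket y * (2 * (b⁻¹ ^ 3 + a⁻¹ ^ 3)) := by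
        gcongr
        generalize a⁻¹ = p at *
        generalize b⁻¹ = q at *
        -- Expanding `(p+q)(p-q)² ≥ 0` gives `pq² + p²q ≤ p³ + q³`.
        nlinarith [mul_nonneg (add_pos hp hq).le (sq_nonneg (p - q)), pow_pos hp 3, pow_pos hq 3]
  calc |(r ^ 2)⁻¹ - (a ^ 2)⁻¹| ≤ |(r ^ 2)⁻¹ - (b ^ 2)⁻¹| + |(b ^ 2)⁻¹ - (a ^ 2)⁻¹| :=
        abs_sub_le _ _ _
    _ ≤ 2 * b⁻¹ ^ 3 + bracket y * (2 * (b⁻¹ ^ 3 + a⁻¹ ^ 3)) := add_le_add h1 h3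
    _ ≤ _ := by
      have : 0 < b⁻¹ ^ 3 := by positivity
      have : 0 < a⁻¹ ^ 3 := by positivity
      nlinarith

lemma nearReal_of_lt {z : R4} (hz : ‖z‖ < 1) : nearReal z = ‖z‖⁻¹ ^ 3 := by
  rw [nearReal, nearKernel, Set.indicator_of_mem (by simpa using hz),
    ENNReal.toReal_ofReal (by positivity), Real.rpow_neg (norm_nonneg z), inv_pow,
    ← Real.rpow_natCast]
  norm_num

/-- The leading term of `𝒢₀ g` at infinity. -/
lemma norm_kernelG0_sub_le (m : ℝ) {x y : R4} (hxy : x ≠ y) (w : C4) :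
    ‖act (kernelG0 m x y) w - (m / (2 * Real.pi ^ 2) * (bracket x ^ 2)⁻¹) • act Iuc w‖ ≤
      (512 + 64 * |m|) * (nearReal (x - y) * ‖w‖ +
        ((bracket (x - y))⁻¹ ^ 3 * (bracket y * ‖w‖) + (bracket x)⁻¹ ^ 3 * (bracket y * ‖w‖))) := by
  have hz : x - y ≠ 0 := sub_ne_zero.2 hxy
  have h0 : 0 < ‖x - y‖ := norm_pos_iff.2 hz
  have hbx := bracket_pos x
  have hby := bracket_pos y
  have hbz := bracket_pos (x - y)
  have hby1 := one_le_bracket y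
  have hpi : |m / (2 * Real.pi ^ 2)| ≤ |m| := by
    rw [abs_div, abs_of_pos (by positivity : 0 < 2 * Real.pi ^ 2)]
    exact div_le_self (abs_nonneg _) (by nlinarith [Real.pi_gt_three])
  have hnear := nearReal_nonneg (x - y)
  have hbz3 : 0 ≤ (bracket (x - y))⁻¹ ^ 3 := by positivity
  have hbx3 : 0 ≤ (bracket x)⁻¹ ^ 3 := by positivity
  rw [← regKernel_zero]
  rcases lt_or_ge ‖x - y‖ 1 with hlt | hge
  -- Near the diagonal nothing cancels: both terms are absorbed by `|x-y|⁻³ ≥ 1`.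
  · have h1 : 1 ≤ ‖x - y‖⁻¹ := (one_le_inv₀ h0).2 hlt.le
    have h2 : ‖x - y‖⁻¹ ^ 2 ≤ ‖x - y‖⁻¹ ^ 3 := pow_le_pow_right₀ h1 (by norm_num)
    have h3 : 1 ≤ ‖x - y‖⁻¹ ^ 3 := one_le_pow₀ h1
    have h4 : ‖(m / (2 * Real.pi ^ 2) * (bracket x ^ 2)⁻¹) • act Iuc w‖ ≤
        |m| * 1 * (16 * ‖w‖) := by
      rw [norm_smul, norm_mul, Real.norm_eq_abs, Real.norm_of_nonneg (by positivity :
        0 ≤ (bracket x ^ 2)⁻¹)]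
      gcongr
      · exact inv_le_one_of_one_le₀ (one_le_pow₀ (one_le_bracket x))
      · exact norm_act_Iuc_le w
    rw [nearReal_of_lt hlt]
    have h5 := norm_act_regKernel_le m le_rfl hz w
    have hw := norm_nonneg w
    calc _ ≤ (64 + 16 * |m|) * (‖x - y‖⁻¹ ^ 2 + ‖x - y‖⁻¹ ^ 3) * ‖w‖ + |m| * 1 * (16 * ‖w‖) :=
          (norm_sub_le _ _).trans (add_le_add h5 h4)
      _ ≤ (64 + 16 * |m|) * (‖x - y‖⁻¹ ^ 3 + ‖x - y‖⁻¹ ^ 3) * ‖w‖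
          + |m| * ‖x - y‖⁻¹ ^ 3 * (16 * ‖w‖) := by gcongr
      _ = (128 + 48 * |m|) * (‖x - y‖⁻¹ ^ 3 * ‖w‖ + (0 + 0)) := by ring
      _ ≤ _ := by gcongr <;> first | positivity | norm_num
  -- Away from the diagonal the `α`-term is already `O(⟨x-y⟩⁻³)`, so only the `I_uc`-term has to be
  -- compared with its leading part.
  · have hbr : ‖x - y‖⁻¹ ≤ 2 * (bracket (x - y))⁻¹ := by
      rw [← div_eq_mul_inv, le_div_iff₀ hbz, inv_mul_le_iff₀ h0]
      nlinarith [bracket_sq (x - y)]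
    have hα : ‖act (regKernel 0 0 (x - y)) w‖ ≤ 512 * (bracket (x - y))⁻¹ ^ 3 * ‖w‖ := by
      refine (norm_act_regKernel_le_radial 0 le_rfl _ _).trans ?_
      rw [add_zero, abs_zero, mul_zero, zero_mul, add_zero]
      have : ‖x - y‖ * (‖x - y‖ ^ 2)⁻¹ ^ 2 = ‖x - y‖⁻¹ ^ 3 := by field_simp
      rw [this]
      calc _ ≤ 64 * (2 * (bracket (x - y))⁻¹) ^ 3 * ‖w‖ := by gcongr
        _ = _ := by ring
    have hI : ‖(m / (2 * Real.pi ^ 2) * ((‖x - y‖ ^ 2)⁻¹ - (bracket x ^ 2)⁻¹)) • act Iuc w‖ ≤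
        |m| * (4 * bracket y * ((bracket (x - y))⁻¹ ^ 3 + (bracket x)⁻¹ ^ 3)) * (16 * ‖w‖) := by
      rw [norm_smul, norm_mul, Real.norm_eq_abs, Real.norm_eq_abs]
      gcongr
      · exact abs_inv_sq_sub_le hge
      · exact norm_act_Iuc_le w
    rw [regKernel_zero_act, add_sub_assoc, ← sub_smul, ← mul_sub]
    calc _ ≤ 512 * (bracket (x - y))⁻¹ ^ 3 * ‖w‖ + |m| * (4 * bracket y *
            ((bracket (x - y))⁻¹ ^ 3 + (bracket x)⁻¹ ^ 3)) * (16 * ‖w‖) :=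
          (norm_add_le _ _).trans (add_le_add hα hI)
      _ ≤ 512 * ((bracket (x - y))⁻¹ ^ 3 * (bracket y * ‖w‖)) + |m| * (4 * bracket y *
            ((bracket (x - y))⁻¹ ^ 3 + (bracket x)⁻¹ ^ 3)) * (16 * ‖w‖) := by
          rw [mul_assoc 512]
          gcongr
          exact le_mul_of_one_le_left (norm_nonneg _) hby1
      _ ≤ _ := by
          have e1 : 0 ≤ nearReal (x - y) * ‖w‖ := by positivity
          have e2 : 0 ≤ (bracket x)⁻¹ ^ 3 * (bracket y * ‖w‖) := by positivity
          nlinarith [mul_nonneg (abs_nonneg m) e1]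

lemma add_sq_le (a b : ℝ≥0∞) : (a + b) ^ 2 ≤ 2 * (a ^ 2 + b ^ 2) := by
  have := ENNReal.rpow_add_le_mul_rpow_add_rpow a b (p := 2) (by norm_num)
  norm_num at this
  exact this

lemma memLp_two_of_lintegral_lt_top {f : R4 → C4} (hm : AEStronglyMeasurable f volume)
    (hf : ∫⁻ x, ‖f x‖ₑ ^ 2 < ⊤) : MemLp f 2 volume := by
  refine ⟨hm, ?_⟩
  rw [eLpNorm_eq_lintegral_rpow_enorm_toReal (by norm_num) (by norm_num)]
  refine ENNReal.rpow_lt_top_of_nonneg (by norm_num) ?_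
  simpa using hf.ne

lemma lintegral_sq_lt_top {E : Type*} [NormedAddCommGroup E] {f : R4 → E} (hf : MemLp f 2 volume) :
    ∫⁻ x, ‖f x‖ₑ ^ 2 < ⊤ := by
  have h := lintegral_rpow_enorm_lt_top_of_eLpNorm_lt_top (by norm_num) (by norm_num) hf.2
  simpa using h

/-- The convolution of an `L²` function with an `L¹` function is in `L²`. -/
lemma lintegral_conv_sq_le {k h : R4 → ℝ≥0∞} (hk : Measurable k) (hh : AEMeasurable h volume)
    (hh1 : ∫⁻ y, h y ≠ ⊤) :
    ∫⁻ x, (∫⁻ y, k (x - y) * h y) ^ 2 ≤ (∫⁻ y, h y) ^ 2 * ∫⁻ z, k z ^ 2 := by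
  have hm : ∀ x, Measurable fun y => k (x - y) := fun x => hk.comp (by fun_prop)
  have hm' : Measurable fun p : R4 × R4 => k (p.1 - p.2) := hk.comp (by fun_prop)
  calc ∫⁻ x, (∫⁻ y, k (x - y) * h y) ^ 2
      ≤ ∫⁻ x, (∫⁻ y, h y) * ∫⁻ y, h y * k (x - y) ^ 2 := by
        refine lintegral_mono fun x => ?_
        simp only [mul_comm (k _)]
        exact cauchySchwarz_weight hh (hm x).aemeasurable
    _ = (∫⁻ y, h y) * ∫⁻ x, ∫⁻ y, h y * k (x - y) ^ 2 := lintegral_const_mul' _ _ hh1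
    _ = (∫⁻ y, h y) * ∫⁻ y, ∫⁻ x, h y * k (x - y) ^ 2 := by
        rw [lintegral_lintegral_swap]
        exact (hh.comp_quasiMeasurePreserving Measure.quasiMeasurePreserving_snd).mul
          (hm'.pow_const 2).aemeasurable
    _ = (∫⁻ y, h y) * ∫⁻ y, h y * ∫⁻ z, k z ^ 2 := by
        congr 1
        refine lintegral_congr fun y => ?_
        have hy : Measurable fun x => k (x - y) ^ 2 := (hk.comp (by fun_prop)).pow_const 2
        rw [lintegral_const_mul _ hy, lintegral_sub_right_eq_self (fun z => k z ^ 2) y]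
    _ = (∫⁻ y, h y) ^ 2 * ∫⁻ z, k z ^ 2 := by
        rw [lintegral_mul_const'' _ hh, pow_two, mul_assoc]

lemma memLp_bracket_inv_cube : MemLp (fun x : R4 => (bracket x)⁻¹ ^ 3) 2 volume := by
  refine (memLp_bracket_rpow one_pos).congr_norm
    (measurable_bracket.inv.pow_const 3).aestronglyMeasurable (Eventually.of_forall fun x => ?_)
  congr 1
  rw [Real.rpow_neg (bracket_pos x).le, inv_pow, ← Real.rpow_natCast]
  norm_num

lemma ofReal_nearReal (z : R4) : ENNReal.ofReal (nearReal z) = nearKernel z :=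
  ENNReal.ofReal_toReal (nearKernel_ne_top z)

/-- Up to a square integrable error, `𝒢₀ g` is `(m / 2π²) ⟨x⟩⁻² M_uc g`. -/
lemma memLp_kernelG0_sub (m : ℝ) {g : R4 → C4} (hg2 : MemLp g 2 volume)
    (hg : Integrable g volume) (hbg : Integrable (fun y => bracket y * ‖g y‖) volume) :
    MemLp (fun x => (∫ y, act (kernelG0 m x y) (g y)) -
      (m / (2 * Real.pi ^ 2) * (bracket x ^ 2)⁻¹) • Muc g) 2 volume := by
  set K : ℝ≥0∞ := ENNReal.ofReal (512 + 64 * |m|) with hK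
  set k : R4 → ℝ≥0∞ := fun z => ‖(bracket z)⁻¹ ^ 3‖ₑ with hk
  set h : R4 → ℝ≥0∞ := fun y => ‖bracket y * ‖g y‖‖ₑ with hh
  have hkm : Measurable k := (measurable_bracket.inv.pow_const 3).enorm
  have hhm : AEMeasurable h volume := hbg.1.enorm
  have hh1 : ∫⁻ y, h y < ⊤ := hbg.2
  have hk2 : ∫⁻ z, k z ^ 2 < ⊤ := lintegral_sq_lt_top memLp_bracket_inv_cube
  have hgm : AEMeasurable (fun y => ‖g y‖ₑ) volume := hg.1.enorm
  have hmeas : AEStronglyMeasurable (fun x => (∫ y, act (kernelG0 m x y) (g y)) -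
      (m / (2 * Real.pi ^ 2) * (bracket x ^ 2)⁻¹) • Muc g) volume := by
    refine AEStronglyMeasurable.sub ?_ ?_
    · simp only [← regKernel_zero]
      exact (aestronglyMeasurable_regKernel m 0 hg.1).integral_prod_right'
    · exact ((measurable_bracket.pow_const 2).inv.const_mul _).aestronglyMeasurable.smul_const _
  refine memLp_two_of_lintegral_lt_top hmeas ?_
  -- The three errors are square integrable for different reasons: an `L¹` kernel convolved with `g
  -- ∈ L²`, an `L²` kernel convolved with `⟨y⟩|g| ∈ L¹`, and `⟨x⟩⁻³ ∈ L²` times a constant.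
  have hpt : ∀ᵐ x, ‖(∫ y, act (kernelG0 m x y) (g y)) -
      (m / (2 * Real.pi ^ 2) * (bracket x ^ 2)⁻¹) • Muc g‖ₑ ≤
      K * ((∫⁻ y, nearKernel (x - y) * ‖g y‖ₑ) + ((∫⁻ y, k (x - y) * h y) + k x * ∫⁻ y, h y)) := by
    filter_upwards [ae_integrable_dominator hg] with x hx
    have hi1 := integrable_act_regKernel m le_rfl hg.1 hx
    simp only [regKernel_zero] at hi1
    have hi2 : Integrable (fun y => (m / (2 * Real.pi ^ 2) * (bracket x ^ 2)⁻¹) • act Iuc (g y))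
        volume := ((act Iuc).integrable_comp hg).fun_smul _
    rw [Muc, ← integral_smul, ← integral_sub hi1 hi2]
    refine (enorm_integral_le_lintegral_enorm _).trans ?_
    have hm1 : AEMeasurable (fun y => nearKernel (x - y) * ‖g y‖ₑ) volume :=
      (measurable_nearKernel.comp (by fun_prop)).aemeasurable.mul hgm
    have hm2 : AEMeasurable (fun y => k (x - y) * h y) volume :=
      (hkm.comp (by fun_prop)).aemeasurable.mul hhm
    rw [← lintegral_const_mul'' _ hhm, ← lintegral_add_left' hm2, ← lintegral_add_left' hm1,
      ← lintegral_const_mul' _ _ ENNReal.ofReal_ne_top]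
    refine lintegral_mono_ae ?_
    filter_upwards [Measure.ae_ne volume x] with y hy
    have hbx := bracket_pos x
    have hby := bracket_pos y
    have hbz := bracket_pos (x - y)
    have hn := nearReal_nonneg (x - y)
    rw [← ofReal_norm]
    refine (ENNReal.ofReal_le_ofReal (norm_kernelG0_sub_le m hy.symm (g y))).trans_eq ?_
    rw [ENNReal.ofReal_mul (by positivity),
      ENNReal.ofReal_add (p := nearReal (x - y) * ‖g y‖) (by positivity) (by positivity),
      ENNReal.ofReal_add (p := (bracket (x - y))⁻¹ ^ 3 * (bracket y * ‖g y‖)) (by positivity)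
        (by positivity), ENNReal.ofReal_mul hn,
      ENNReal.ofReal_mul (p := (bracket (x - y))⁻¹ ^ 3) (by positivity),
      ENNReal.ofReal_mul (p := (bracket x)⁻¹ ^ 3) (by positivity), ofReal_nearReal, ofReal_norm]
    simp only [hk, hh]
    rw [← Real.enorm_eq_ofReal (by positivity : 0 ≤ (bracket (x - y))⁻¹ ^ 3),
      ← Real.enorm_eq_ofReal (by positivity : 0 ≤ (bracket x)⁻¹ ^ 3),
      ← Real.enorm_eq_ofReal (by positivity : 0 ≤ bracket y * ‖g y‖)]
  have hnm : AEMeasurable (fun x => (∫⁻ y, nearKernel (x - y) * ‖g y‖ₑ) ^ 2) volume := by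
    refine AEMeasurable.pow_const (AEMeasurable.lintegral_prod_right' (f := fun p : R4 × R4 =>
      nearKernel (p.1 - p.2) * ‖g p.2‖ₑ) ?_) 2
    exact (measurable_nearKernel.comp (by fun_prop)).aemeasurable.mul
      (hgm.comp_quasiMeasurePreserving Measure.quasiMeasurePreserving_snd)
  have hcm : AEMeasurable (fun x => (∫⁻ y, k (x - y) * h y) ^ 2) volume := by
    refine AEMeasurable.pow_const (AEMeasurable.lintegral_prod_right' (f := fun p : R4 × R4 =>
      k (p.1 - p.2) * h p.2) ?_) 2
    exact (hkm.comp (by fun_prop)).aemeasurable.mul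
      (hhm.comp_quasiMeasurePreserving Measure.quasiMeasurePreserving_snd)
  calc _ ≤ ∫⁻ x, K ^ 2 * (2 * ((∫⁻ y, nearKernel (x - y) * ‖g y‖ₑ) ^ 2 +
        2 * ((∫⁻ y, k (x - y) * h y) ^ 2 + k x ^ 2 * (∫⁻ y, h y) ^ 2))) := by
        refine lintegral_mono_ae ?_
        filter_upwards [hpt] with x hx
        refine (pow_le_pow_left₀ zero_le hx 2).trans ?_
        rw [mul_pow, ← mul_pow (k x)]
        gcongr
        refine (add_sq_le _ _).trans ?_
        gcongr
        exact add_sq_le _ _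
    _ = K ^ 2 * (2 * ((∫⁻ x, (∫⁻ y, nearKernel (x - y) * ‖g y‖ₑ) ^ 2) +
        2 * ((∫⁻ x, (∫⁻ y, k (x - y) * h y) ^ 2) + (∫⁻ x, k x ^ 2) * (∫⁻ y, h y) ^ 2))) := by
        rw [lintegral_const_mul' _ _ (ENNReal.pow_ne_top ENNReal.ofReal_ne_top),
          lintegral_const_mul' _ _ (by norm_num), lintegral_add_left' hnm,
          lintegral_const_mul' _ _ (by norm_num), lintegral_add_left' hcm,
          lintegral_mul_const _ (hkm.pow_const 2)]
    _ ≤ K ^ 2 * (2 * ((∫⁻ z, nearKernel z) ^ 2 * (∫⁻ y, ‖g y‖ₑ ^ 2) +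
        2 * ((∫⁻ y, h y) ^ 2 * (∫⁻ z, k z ^ 2) + (∫⁻ x, k x ^ 2) * (∫⁻ y, h y) ^ 2))) := by
        gcongr
        · exact lintegral_near_sq_le hgm
        · exact lintegral_conv_sq_le hkm hhm hh1.ne
    _ < ⊤ := by
        have h1 := lintegral_nearKernel_lt_top
        have h2 := lintegral_sq_lt_top hg2
        have h3 : K < ⊤ := ENNReal.ofReal_lt_top
        have two : (2 : ℝ≥0∞) < ⊤ := by norm_num
        refine ENNReal.mul_lt_top (ENNReal.pow_lt_top h3) (ENNReal.mul_lt_top two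
          (ENNReal.add_lt_top.2 ⟨ENNReal.mul_lt_top (ENNReal.pow_lt_top h1) h2,
          ENNReal.mul_lt_top two (ENNReal.add_lt_top.2
            ⟨ENNReal.mul_lt_top (ENNReal.pow_lt_top hh1) hk2,
             ENNReal.mul_lt_top hk2 (ENNReal.pow_lt_top hh1)⟩)⟩))

section factorization

variable {V : R4 → Mat4} (F : Diagonalization V)

lemma memLp_V (hv : DecaysFasterThan 2 F.v) {ψ : R4 → C4} (hm : AEStronglyMeasurable ψ volume)
    (hW : MemLp (fun x => (bracket x)⁻¹ * ‖ψ x‖) 2 volume) :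
    MemLp (fun x => act (V x) (ψ x)) 2 volume := by
  obtain ⟨C, s, hs, hC0, hC⟩ := exists_norm_act_V_le F hv
  refine (hW.const_mul C).mono (aestronglyMeasurable_V F hm) (Eventually.of_forall fun x => ?_)
  have hb := bracket_pos x
  rw [Real.norm_of_nonneg (by positivity), ← mul_assoc]
  refine (hC x _).trans ?_
  gcongr
  rw [← Real.rpow_neg_one]
  exact Real.rpow_le_rpow_of_exponent_le (one_le_bracket x) (by linarith)

/-- By the integral equation, `ψ` is `-(m/2π²)⟨x⟩⁻² M_uc Vψ` plus an `L²` function. As `m > 0` and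
`⟨x⟩⁻² ∉ L²`, the leading term is square integrable only if its coefficient is zero. -/
lemma memLp_iff_Muc_eq_zero {m : ℝ} (hm : 0 < m) (hv : DecaysFasterThan 2 F.v) {ψ : R4 → C4}
    (h : IsDistributionalSolution m V ψ)
    (hW : MemLp (fun x => (bracket x)⁻¹ * ‖ψ x‖) 2 volume) :
    MemLp ψ 2 volume ↔ Muc (fun x => act (V x) (ψ x)) = 0 := by
  have hψm : AEStronglyMeasurable ψ volume := h.1.aestronglyMeasurable
  have hg := integrable_V F hv hψm hW
  have key := memLp_kernelG0_sub m (memLp_V F hv hψm hW) hg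
    (integrable_bracket_mul_norm_V F hv hψm hW)
  set c := Muc (fun x => act (V x) (ψ x)) with hc
  have hψ := h.ae_eq hg hW
  constructor
  · intro h2
    by_contra hc0
    have h3 := key.add h2
    refine not_memLp_bracket_sq_inv ?_
    have hmpi : 0 < m / (2 * Real.pi ^ 2) := by have := Real.pi_pos; positivity
    have h4 : MemLp (fun x : R4 => (m / (2 * Real.pi ^ 2) * (bracket x ^ 2)⁻¹) • c) 2 volume := by
      refine h3.neg.ae_eq ?_
      filter_upwards [hψ] with x hx
      simp only [Pi.neg_apply, Pi.add_apply]
      rw [hx]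
      abel
    refine (h4.norm.const_mul ((m / (2 * Real.pi ^ 2) * ‖c‖)⁻¹)).congr_norm
      (measurable_bracket.pow_const 2).inv.aestronglyMeasurable (Eventually.of_forall fun x => ?_)
    congr 1
    have hb := bracket_pos x
    have hcn : 0 < ‖c‖ := norm_pos_iff.2 hc0
    rw [norm_smul, Real.norm_of_nonneg (by positivity)]
    field_simp
  · intro hc0
    rw [hc0] at key
    simp only [smul_zero, sub_zero] at key
    refine key.neg.ae_eq ?_
    filter_upwards [hψ] with x hx
    rw [hx, Pi.neg_apply]

end factorization

/-! ### The subspace `S₂L²` -/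

lemma Iuc_act_act (w : C4) : act Iuc (act Iuc w) = act Iuc w := by
  rw [← act_mul]
  congr 2
  ext i j
  fin_cases i <;> fin_cases j <;> simp [Iuc, beta, Matrix.mul_apply, Fin.sum_univ_four, mul_add] <;>
    norm_num

section threshold

variable {V : R4 → Mat4} (m : ℝ) (F : Diagonalization V) (hv : DecaysFasterThan 2 F.v)

lemma integrable_conjTranspose_v (hv : DecaysFasterThan 2 F.v) {f : R4 → C4}
    (hf : MemLp f 2 volume) :
    Integrable (fun y => act (F.v y).conjTranspose (f y)) volume := by
  obtain ⟨C, s, hs, hC0, hC⟩ := exists_norm_act_v_le F hv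
  have hm : AEStronglyMeasurable (fun y => act (F.v y).conjTranspose (f y)) volume := by
    refine aestronglyMeasurable_act (fun i j => ?_) hf.1
    simp only [Matrix.conjTranspose_apply]
    exact continuous_star.measurable.comp (F.measurable_v j i)
  refine (((memLp_bracket_rpow hs).integrable_mul hf.norm).const_mul C).mono' hm
    (Eventually.of_forall fun x => ?_)
  refine ((hC x _).2).trans_eq ?_
  simp only [Pi.mul_apply]
  ring

lemma sandwichFun_kernelG1 (f : R4 → C4) (x : R4) :
    sandwichFun F.v (kernelG1 m) f x = act (F.v x)
      (((m / (2 * Real.pi ^ 2) : ℝ) : ℂ) • Muc fun y => act (F.v y).conjTranspose (f y)) := by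
  have h : ∀ w, act (((m / (2 * Real.pi ^ 2) : ℝ) : ℂ) • Iuc) w =
      ((m / (2 * Real.pi ^ 2) : ℝ) : ℂ) • act Iuc w := fun w => by
    simp only [act, map_smul, smul_apply]
  simp only [sandwichFun, kernelG1, h, integral_smul, Muc]

lemma coeFn_T1 (φ : L2) : T1 m F hv φ =ᵐ[volume] sandwichFun F.v (kernelG1 m) φ :=
  MemLp.coeFn_toLp (sandwich_memLp F.measurable_v hv (measurable_kernelG1 m) (kernelBound_G1 m)
    (Lp.memLp φ))

/-- The kernel of `𝒢₁` is constant, so `T₁` factors through the single spinor `M_uc v*φ`. Since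
`I_uc` is an orthogonal projection, the quadratic form of `T₁` is a nonnegative multiple of the
squared norm of that spinor. -/
lemma inner_T1_self (φ : L2) : inner ℂ (T1 m F hv φ) φ = ((m / (2 * Real.pi ^ 2) : ℝ) : ℂ) *
    ((‖Muc fun y => act (F.v y).conjTranspose (φ y)‖ ^ 2 : ℝ) : ℂ) := by
  have hi := integrable_conjTranspose_v F hv (Lp.memLp φ)
  set M := Muc fun y => act (F.v y).conjTranspose (φ y) with hM
  have hM2 : M = act Iuc (∫ y, act (F.v y).conjTranspose (φ y)) :=
    (act Iuc).integral_comp_comm hi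
  have h1 : inner ℂ (T1 m F hv φ) φ =
      ∫ x, inner ℂ (((m / (2 * Real.pi ^ 2) : ℝ) : ℂ) • M) (act (F.v x).conjTranspose (φ x)) := by
    rw [L2.inner_def]
    refine integral_congr_ae ?_
    filter_upwards [coeFn_T1 m F hv φ] with x hx
    rw [hx, sandwichFun_kernelG1, inner_act]
  rw [h1, integral_inner hi, inner_smul_left, Complex.conj_ofReal]
  congr 1
  have h2 : inner ℂ M (∫ y, act (F.v y).conjTranspose (φ y)) = inner ℂ M M := by
    conv_rhs => rw [hM2, inner_act, conjTranspose_Iuc, Iuc_act_act, ← conjTranspose_Iuc, ← inner_act]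
    rw [← hM2]
  rw [h2, inner_self_eq_norm_sq_to_K]
  simp

/-- If `S₁T₁S₁φ = 0`, pairing with `φ = S₁φ` makes the quadratic form of `T₁` vanish, hence `M_uc
v*φ = 0`. Conversely, `M_uc v*φ = 0` already forces `T₁φ = 0`. -/
lemma mem_S2L2_iff (hm : 0 < m) {φ : L2} (hφ : φ ∈ S1L2 m F hv) :
    φ ∈ S2L2 m F hv ↔ Muc (fun y => act (F.v y).conjTranspose (φ y)) = 0 := by
  have hS : S1 m F hv φ = φ := Submodule.starProjection_eq_self_iff.2 hφ
  rw [S2L2, Submodule.mem_inf, and_iff_right hφ, LinearMap.mem_ker]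
  change S1 m F hv (T1 m F hv (S1 m F hv φ)) = 0 ↔ _
  rw [hS]
  constructor
  · intro h
    have h1 : inner ℂ (T1 m F hv φ) φ = 0 := by
      rw [← hS, S1, ← Submodule.inner_starProjection_left_eq_right]
      change inner ℂ (S1 m F hv (T1 m F hv (S1 m F hv φ))) φ = 0
      rw [hS, h, inner_zero_left]
    rw [inner_T1_self, mul_eq_zero, Complex.ofReal_eq_zero, Complex.ofReal_eq_zero] at h1
    have hmpi : m / (2 * Real.pi ^ 2) ≠ 0 := by have := Real.pi_pos; positivity
    simpa using h1.resolve_left hmpi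
  · intro h
    have h1 : T1 m F hv φ = 0 := by
      rw [Lp.eq_zero_iff_ae_eq_zero]
      filter_upwards [coeFn_T1 m F hv φ] with x hx
      rw [hx, sandwichFun_kernelG1, h, smul_zero, map_zero, Pi.zero_apply]
    rw [h1, map_zero]

end threshold

/-! ### Boundedness -/

/-- This is Young's inequality `L¹ * L² ⊆ L²`, via Cauchy–Schwarz with respect to the weight `k(x -
·)` and Tonelli. -/
lemma lintegral_conv_sq_le_of_lintegral {k f : R4 → ℝ≥0∞} (hk : Measurable k)
    (hk1 : ∫⁻ z, k z ≠ ⊤) (hf : AEMeasurable f volume) :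
    ∫⁻ x, (∫⁻ y, k (x - y) * f y) ^ 2 ≤ (∫⁻ z, k z) ^ 2 * ∫⁻ y, f y ^ 2 := by
  have hm : ∀ x, Measurable fun y => k (x - y) := fun x => hk.comp (by fun_prop)
  have hm' : Measurable fun p : R4 × R4 => k (p.1 - p.2) := hk.comp (by fun_prop)
  calc ∫⁻ x, (∫⁻ y, k (x - y) * f y) ^ 2
      ≤ ∫⁻ x, (∫⁻ z, k z) * ∫⁻ y, k (x - y) * f y ^ 2 := by
        refine lintegral_mono fun x => ?_
        refine (cauchySchwarz_weight (hm x).aemeasurable hf).trans_eq ?_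
        rw [lintegral_sub_left_eq_self k x]
    _ = (∫⁻ z, k z) * ∫⁻ y, ∫⁻ x, k (x - y) * f y ^ 2 := by
        rw [lintegral_const_mul' _ _ hk1, lintegral_lintegral_swap]
        exact hm'.aemeasurable.mul ((hf.pow_const 2).comp_quasiMeasurePreserving
          Measure.quasiMeasurePreserving_snd)
    _ = (∫⁻ z, k z) * ∫⁻ y, (∫⁻ z, k z) * f y ^ 2 := by
        congr 1
        refine lintegral_congr fun y => ?_
        have hy : Measurable fun x => k (x - y) := hk.comp (by fun_prop)
        rw [lintegral_mul_const _ hy, lintegral_sub_right_eq_self k y]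
    _ = (∫⁻ z, k z) ^ 2 * ∫⁻ y, f y ^ 2 := by
        rw [lintegral_const_mul' _ _ hk1, pow_two, mul_assoc]

/-- An `L²` function dominated by a constant plus its convolution with a small kernel is bounded. -/
lemma ae_le_of_le_add_conv {k u : R4 → ℝ≥0∞} {c : ℝ≥0∞} (hk : Measurable k)
    (hk1 : ∫⁻ z, k z ≤ 1 / 2) (hum : AEMeasurable u volume) (hu2 : ∫⁻ x, u x ^ 2 < ⊤)
    (hu : ∀ᵐ x, u x ≤ c + ∫⁻ y, k (x - y) * u y) : ∀ᵐ x, u x ≤ 2 * c := by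
  have hkt : ∫⁻ z, k z ≠ ⊤ := (hk1.trans_lt (by norm_num)).ne
  -- Subtraction is truncated, so `h` is the positive part of `u - 2c`. The level `2c` solves `2c =
  -- c + (1/2)(2c)`, so the constants cancel and `h ≤ k * h` remains.
  set h : R4 → ℝ≥0∞ := fun x => u x - 2 * c with hh
  have hhm : AEMeasurable h volume := hum.sub_const _
  have hle : ∀ᵐ x, h x ≤ ∫⁻ y, k (x - y) * h y := by
    filter_upwards [hu] with x hx
    rw [hh, tsub_le_iff_left]
    have hm : Measurable fun y => k (x - y) * (2 * c) := (hk.comp (by fun_prop)).mul_const _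
    calc u x ≤ c + ∫⁻ y, k (x - y) * u y := hx
      _ ≤ c + ∫⁻ y, (k (x - y) * (2 * c) + k (x - y) * h y) := by
        gcongr with y
        rw [← mul_add]
        gcongr
        exact le_add_tsub
      _ = c + ((∫⁻ z, k z) * (2 * c) + ∫⁻ y, k (x - y) * h y) := by
        have hkx : Measurable fun y => k (x - y) := hk.comp (by fun_prop)
        rw [lintegral_add_left hm, lintegral_mul_const _ hkx, lintegral_sub_left_eq_self k x]
      _ ≤ c + (1 / 2 * (2 * c) + ∫⁻ y, k (x - y) * h y) := by gcongr
      _ = 2 * c + ∫⁻ y, k (x - y) * h y := by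
        rw [← mul_assoc, one_div, ENNReal.inv_mul_cancel (by norm_num) (by norm_num), one_mul,
          ← add_assoc, two_mul]
  -- Finiteness turns `‖h‖² ≤ ½‖h‖²` into `h = 0`; this is where `u ∈ L²` enters.
  have hfin : ∫⁻ x, h x ^ 2 < ⊤ :=
    lt_of_le_of_lt (lintegral_mono fun x => pow_le_pow_left₀ zero_le tsub_le_self 2) hu2
  have hcontr : ∫⁻ x, h x ^ 2 ≤ 1 / 2 * ∫⁻ x, h x ^ 2 := by
    calc ∫⁻ x, h x ^ 2 ≤ ∫⁻ x, (∫⁻ y, k (x - y) * h y) ^ 2 :=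
          lintegral_mono_ae (hle.mono fun x hx => pow_le_pow_left₀ zero_le hx 2)
      _ ≤ (∫⁻ z, k z) ^ 2 * ∫⁻ y, h y ^ 2 := lintegral_conv_sq_le_of_lintegral hk hkt hhm
      _ ≤ 1 / 2 * ∫⁻ y, h y ^ 2 := by
        gcongr
        calc (∫⁻ z, k z) ^ 2 ≤ (1 / 2) ^ 2 := pow_le_pow_left₀ zero_le hk1 2
          _ ≤ 1 / 2 := pow_le_of_le_one zero_le (by norm_num) two_ne_zero
  have hzero : ∫⁻ x, h x ^ 2 = 0 := by
    by_contra h0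
    have := ENNReal.half_lt_self h0 hfin.ne
    rw [one_div, mul_comm, ← div_eq_mul_inv] at hcontr
    exact absurd hcontr (not_le.2 this)
  filter_upwards [(lintegral_eq_zero_iff' (hhm.pow_const 2)).1 hzero] with x hx
  have : h x = 0 := by simpa using hx
  exact tsub_eq_zero_iff_le.1 this

/-- The truncated difference is the part of the singularity above height `n`. It decreases to zero
and is dominated by an integrable function. -/
lemma exists_lintegral_nearKernel_sub_le {K : ℝ≥0∞} (hK : K ≠ ⊤) :
    ∃ n : ℕ, ∫⁻ z, K * (nearKernel z - n) ≤ 1 / 2 := by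
  have ht : Tendsto (fun n : ℕ => ∫⁻ z, K * (nearKernel z - n)) atTop (nhds (∫⁻ _z : R4, 0)) := by
    refine tendsto_lintegral_of_dominated_convergence (fun z => K * nearKernel z)
      (fun n => (measurable_nearKernel.sub_const _).const_mul _)
      (fun n => Eventually.of_forall fun z => mul_le_mul_right tsub_le_self K) ?_
      (Eventually.of_forall fun z => tendsto_const_nhds.congr' ?_)
    · rw [lintegral_const_mul _ measurable_nearKernel]
      exact ENNReal.mul_ne_top hK lintegral_nearKernel_lt_top.ne
    · obtain ⟨N, hN⟩ := ENNReal.exists_nat_gt (nearKernel_ne_top z)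
      filter_upwards [eventually_ge_atTop N] with n hn
      have : nearKernel z ≤ n := hN.le.trans (by exact_mod_cast hn)
      rw [tsub_eq_zero_of_le this, mul_zero]
  rw [lintegral_zero] at ht
  exact ((tendsto_order.1 ht).2 (1 / 2) (by norm_num)).exists.imp fun n hn => hn.le

/-- In `ψ = -𝒢₀Vψ` the singularity is cut at height `n`. The part below acts on `Vψ ∈ L¹` and gives
a constant. For the part above, `V` is bounded, so it is a convolution of `|ψ|` with a kernel of
mass at most `1/2`. -/
lemma IsThresholdEigenfunction.memLp_top {m : ℝ} {V : R4 → Mat4} (F : Diagonalization V)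
    (hv : DecaysFasterThan 2 F.v) {ψ : R4 → C4} (h : IsThresholdEigenfunction m V ψ) :
    MemLp ψ ⊤ volume := by
  obtain ⟨h2, -, hsol⟩ := h
  have hW := memLp_bracket_inv_of_memLp h2
  have hg := integrable_V F hv h2.1 hW
  obtain ⟨C, s, hs, hC0, hC⟩ := exists_norm_act_V_le F hv
  have hVψ : ∀ y, ‖act (V y) (ψ y)‖ₑ ≤ ENNReal.ofReal C * ‖ψ y‖ₑ := fun y => by
    rw [← ofReal_norm, ← ofReal_norm, ← ENNReal.ofReal_mul hC0]
    refine ENNReal.ofReal_le_ofReal ((hC y _).trans ?_)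
    gcongr
    exact mul_le_of_le_one_right hC0
      (Real.rpow_le_one_of_one_le_of_nonpos (one_le_bracket y) (by linarith))
  set K : ℝ≥0∞ := ENNReal.ofReal (2 * (64 + 16 * |m|)) with hK
  have hKt : K ≠ ⊤ := ENNReal.ofReal_ne_top
  set D : ℝ≥0∞ := K * ENNReal.ofReal C with hD
  have hDt : D ≠ ⊤ := ENNReal.mul_ne_top hKt ENNReal.ofReal_ne_top
  obtain ⟨n, hn⟩ := exists_lintegral_nearKernel_sub_le hDt
  set G : ℝ≥0∞ := ∫⁻ y, ‖act (V y) (ψ y)‖ₑ with hG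
  have hGt : G ≠ ⊤ := hg.2.ne
  have hgm : AEMeasurable (fun y => ‖act (V y) (ψ y)‖ₑ) volume := hg.1.enorm
  have hle : ∀ᵐ x, ‖ψ x‖ₑ ≤ K * (2 + n) * G + ∫⁻ y, D * (nearKernel (x - y) - n) * ‖ψ y‖ₑ := by
    filter_upwards [hsol.ae_eq hg hW] with x hx
    rw [hx, enorm_neg]
    refine (enorm_integral_le_lintegral_enorm _).trans ?_
    rw [hG, ← lintegral_const_mul'' _ hgm, ← lintegral_add_left' (hgm.const_mul _)]
    refine lintegral_mono_ae ?_
    filter_upwards [Measure.ae_ne volume x] with y hy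
    have h1 := norm_act_regKernel_le_near m le_rfl (sub_ne_zero.2 hy.symm) (act (V y) (ψ y))
    have hnear := nearReal_nonneg (x - y)
    rw [regKernel_zero] at h1
    have h3 : ‖act (kernelG0 m x y) (act (V y) (ψ y))‖ₑ ≤
        K * (‖act (V y) (ψ y)‖ₑ * (2 + nearKernel (x - y))) := by
      rw [← ofReal_norm]
      refine (ENNReal.ofReal_le_ofReal h1).trans_eq ?_
      rw [ENNReal.ofReal_mul (by positivity), ENNReal.ofReal_mul (norm_nonneg _),
        ENNReal.ofReal_add (by norm_num) hnear, ofReal_nearReal, ofReal_norm]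
      norm_num [hK]
    refine h3.trans ?_
    calc K * (‖act (V y) (ψ y)‖ₑ * (2 + nearKernel (x - y)))
        ≤ K * (‖act (V y) (ψ y)‖ₑ * (2 + (n + (nearKernel (x - y) - n)))) := by
          gcongr
          exact le_add_tsub
      _ = K * (2 + n) * ‖act (V y) (ψ y)‖ₑ +
          K * (nearKernel (x - y) - n) * ‖act (V y) (ψ y)‖ₑ := by ring
      _ ≤ K * (2 + n) * ‖act (V y) (ψ y)‖ₑ +
          K * (nearKernel (x - y) - n) * (ENNReal.ofReal C * ‖ψ y‖ₑ) := by
          gcongr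
          exact hVψ y
      _ = _ := by rw [hD]; ring
  have hb := ae_le_of_le_add_conv ((measurable_nearKernel.sub_const (n : ℝ≥0∞)).const_mul D) hn
    h2.1.enorm (lintegral_sq_lt_top h2) hle
  have hct : 2 * (K * (2 + n) * G) ≠ ⊤ :=
    ENNReal.mul_ne_top (by norm_num) (ENNReal.mul_ne_top (ENNReal.mul_ne_top hKt
      (ENNReal.add_ne_top.2 ⟨by norm_num, ENNReal.natCast_ne_top n⟩)) hGt)
  refine ⟨h2.1, ?_⟩
  rw [eLpNorm_exponent_top]
  exact (essSup_le_of_ae_le _ hb).trans_lt hct.lt_top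

end

end Dirac4

/-! ### The equivalences and the boundedness -/

theorem lemma5p2 (m : ℝ) (hm : 0 < m) (V : Dirac4.R4 → Dirac4.Mat4)
    (F : Dirac4.Diagonalization V) (hv : Dirac4.DecaysFasterThan 2 F.v) :
    (∀ (φ : Dirac4.L2) (ψ : Dirac4.R4 → Dirac4.C4) (ε : ℝ), 0 < ε → ε ≤ 1 →
      Dirac4.MemL2Weighted (-ε) ψ →
      ¬ ψ =ᵐ[volume] 0 →
      Dirac4.IsDistributionalSolution m V ψ →
      φ =ᵐ[volume] (fun x => Dirac4.act (F.U x) (Dirac4.act (F.v x) (ψ x))) →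
      φ ∈ Dirac4.S1L2 m F hv →
        (φ ∈ Dirac4.S2L2 m F hv ↔ MemLp ψ 2 volume) ∧
        (φ ∈ Dirac4.S2L2 m F hv ↔ Dirac4.IsThresholdEigenfunction m V ψ) ∧
        (φ ∈ Dirac4.S2L2 m F hv ↔
          Dirac4.Muc (fun y => Dirac4.act (F.v y).conjTranspose (φ y)) = 0)) ∧
    (∀ ψ : Dirac4.R4 → Dirac4.C4,
      Dirac4.IsThresholdEigenfunction m V ψ → MemLp ψ ⊤ volume) := by
  refine ⟨fun φ ψ ε _ hε1 hψW hψ0 hsol hφ hφS => ?_, fun ψ h => h.memLp_top F hv⟩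
  have hW := Dirac4.memLp_bracket_inv_of_weighted hε1 hψW hsol.1.aestronglyMeasurable
  -- Here `v*φ = v*Uvψ = Vψ`, which links the operator condition on `φ` to the `L²` criterion for
  -- `ψ`.
  have hMuc : Dirac4.Muc (fun y => Dirac4.act (F.v y).conjTranspose (φ y)) =
      Dirac4.Muc (fun y => Dirac4.act (V y) (ψ y)) := by
    refine integral_congr_ae ?_
    filter_upwards [hφ] with y hy
    rw [hy, F.act_V]
  have hd := Dirac4.mem_S2L2_iff m F hv hm hφS
  have hb : φ ∈ Dirac4.S2L2 m F hv ↔ MemLp ψ 2 volume := by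
    rw [hd, hMuc, Dirac4.memLp_iff_Muc_eq_zero F hm hv hsol hW]
  exact ⟨hb, hb.trans ⟨fun h => ⟨h, hψ0, hsol⟩, fun h => h.1⟩, hd⟩
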